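/- Setting. Let $G$ be a compact metrizable group acting (continuously) transitively by isometries on a compact metric space $(\mathbf S,d)$, let $d\mathbf x$ be the unique $G$-invariant Borel probability measure on $\mathbf S$, and let $H:\mathbf S\times\mathbf S\to\mathbb R$ be nonconstant, symmetric, continuous and such that $H(x,y)$ depends only on $d(x,y)$. Let $\Gamma$ be a tree with root $o$ in which the number of children of the vertices is bounded, and let $\mathcal J:E(\Gamma)\to[0,\infty)$. Write $x\le y$ if $x$ lies on the path from $o$ to $y$, and let $\Gamma(v)$ be the subtree on $\{w: v\le w\}$. A *cutset* is a finite set $C$ of vertices, not containing $o$, that meets every infinite self-avoiding path from $o$ and contains no two vertices $x\neq y$ with $x\le y$. Let $C^i$ be the component of $o$ in $\Gamma\setminus C$ (it is finite). Write $C_n\to\infty$ if every vertex belongs to $C_n^i$ for all large $n$. For $\delta\in\mathbf S^{C}$ let $\mu_C^{\delta}$ be the probability measure on $\mathbf S^{C^i}$ whose density with respect to $d\mathbf x^{C^i}$ is $Z^{-1}\exp(-H_C^\delta(\eta))$, where $$H_C^{\delta}(\eta)=\sum_{\overline{xy}\in E(\Gamma),\ x,y\in C^i}\mathcal J(\overline{xy})H(\eta(x),\eta(y))+\sum_{\overline{xy}\in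 E(\Gamma),\ x\in C^i,\ y\in C}\mathcal J(\overline{xy})H(\eta(x),\delta(y)).$$ For $v\in C^i$ let $f_{C,v}^{\delta}$ be the density with respect to $d\mathbf x$ of the marginal at $v$ of the measure defined in the same way on $\mathbf S^{C^i\cap\Gamma(v)}$ from the tree $\Gamma(v)$ rooted at $v$, the cutset $C\cap\Gamma(v)$, and the restrictions of $\mathcal J$ and $\delta$. A *Gibbs state* is a probability measure on $\mathbf S^{V(\Gamma)}$ (with the product $\sigma$-algebra) such that for every cutset $C$ the conditional distribution of the configuration on $C^i$ given the configuration $\delta'$ on $V(\Gamma)\setminus C^i$ is $\mu_C^{\delta}$ with $\delta=\delta'|_C$. Proposition. The following four conditions are equivalent. (i) There is a vertex $v$ such that for every sequence of cutsets $C_n\to\infty$ there are boundary conditions $\delta_n\in\mathbf S^{C_n}$ with $\inf_n\|f_{C_n,v}^{\delta_n}-1\|_\infty\neq 0$. (ii) There are a vertex $v$, a sequence of cutsets $C_n\to\infty$ and boundary conditions $\delta_n\in\mathbf S^{C_n}$ with $\inf_n\|f_{C_n,v}^{\delta_n}-1\|_\infty\neq 0$. (iii) (Symmetry breaking) There is a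 Gibbs state whose marginal distribution at some vertex is not $G$-invariant. (iv) (Phase transition) There is more than one Gibbs state. Here $\|\cdot\|_\infty$ is the norm of $L^\infty(d\mathbf x)$, and the infima are over those $n$ for which $v\in C_n^i$, so that $f_{C_n,v}^{\delta_n}$ is defined. -/

import Mathlib

open MeasureTheory Filter
open scoped ENNReal NNReal

noncomputable section

/-- A rooted tree on the vertex set `V`, with a uniform bound on the number of children of a
vertex (a child of `x` is a neighbour of `x` whose distance to the root is larger by one).
In particular every vertex has finite degree. Leaves are allowed. -/
structure BoundedRootedTree (V : Type*) where
  graph : SimpleGraph V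
  isTree : graph.IsTree
  root : V
  bounded_children : ∃ B : ℕ, ∀ x : V,
    {y : V | graph.Adj x y ∧ graph.dist root y = graph.dist root x + 1}.encard ≤ B

namespace BoundedRootedTree

variable {V : Type*} (T : BoundedRootedTree V)

/-- `T.Below x y` is the relation `x ≤ y`: the vertex `x` lies on the shortest path from the root
to `y`. -/
def Below (x y : V) : Prop :=
  T.graph.dist T.root x + T.graph.dist x y = T.graph.dist T.root y

theorem below_refl (x : V) : T.Below x x := by simp [Below]

/-- An infinite self-avoiding path starting at the root. -/
structure IsRay (γ : ℕ → V) : Prop where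
  start : γ 0 = T.root
  adj : ∀ n, T.graph.Adj (γ n) (γ (n + 1))
  injective : Function.Injective γ

/-- A cutset: a finite antichain of vertices different from the root that meets every infinite
self-avoiding path from the root. -/
structure Cutset where
  carrier : Finset V
  root_notMem : T.root ∉ carrier
  meets : ∀ γ : ℕ → V, T.IsRay γ → ∃ n, γ n ∈ carrier
  antichain : ∀ x ∈ carrier, ∀ y ∈ carrier, T.Below x y → x = y

variable {T}

namespace Cutset

/-- The component of the root after removal of the cutset `C`, as a set: the vertices `x` such that
no vertex of `C` lies on the path from the root to `x`. -/
def insideSet (C : T.Cutset) : Set V := {x | ∀ c ∈ C.carrier, ¬ T.Below c x}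

theorem exists_child {x y : V} (h : T.Below x y) (hne : x ≠ y) :
    ∃ w, (T.graph.Adj x w ∧ T.graph.dist T.root w = T.graph.dist T.root x + 1) ∧ T.Below w y := by
  have hc := T.isTree.connected
  obtain ⟨p, hp⟩ := hc.exists_walk_length_eq_dist x y
  cases p with
  | nil => exact absurd rfl hne
  | @cons _ w _ hadj q =>
    have h1 := SimpleGraph.dist_le q
    have h2 := hc.dist_triangle (u := T.root) (v := w) (w := y)
    have h3 := hc.dist_triangle (u := T.root) (v := x) (w := w)
    have h4 : T.graph.dist x w = 1 := SimpleGraph.dist_eq_one_iff_adj.2 hadj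
    have h5 := hc.dist_triangle (u := x) (v := w) (w := y)
    rw [SimpleGraph.Walk.length_cons] at hp
    unfold Below at *
    exact ⟨w, ⟨hadj, by omega⟩, by omega⟩

/-- The component of the root is finite (König's lemma). -/
theorem insideSet_finite (C : T.Cutset) : C.insideSet.Finite := by
  by_contra hinf
  let P : V → Prop := fun x => (C.insideSet ∩ {y | T.Below x y}).Infinite
  have hroot : P T.root := by
    have : C.insideSet ∩ {y | T.Below T.root y} = C.insideSet := by
      ext y; simp [Below]
    simpa [P, this] using hinf
  have step : ∀ x : V, P x → ∃ w,
      (T.graph.Adj x w ∧ T.graph.dist T.root w = T.graph.dist T.root x + 1) ∧ P w := by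
    intro x hx
    by_contra hno
    push Not at hno
    obtain ⟨B, hB⟩ := T.bounded_children
    have hfin : {y : V | T.graph.Adj x y ∧
        T.graph.dist T.root y = T.graph.dist T.root x + 1}.Finite :=
      Set.finite_of_encard_le_coe (hB x)
    have hU : (⋃ w ∈ {y : V | T.graph.Adj x y ∧
        T.graph.dist T.root y = T.graph.dist T.root x + 1},
        C.insideSet ∩ {y | T.Below w y}).Finite :=
      hfin.biUnion fun w hw => Set.not_infinite.1 (hno w hw)
    refine hx ((hU.union (Set.finite_singleton x)).subset ?_)
    rintro y ⟨hy, hxy⟩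
    by_cases hne : x = y
    · right; exact hne.symm
    · left
      obtain ⟨w, hw, hwy⟩ := exists_child hxy hne
      exact Set.mem_biUnion (show w ∈ {y : V | T.graph.Adj x y ∧
        T.graph.dist T.root y = T.graph.dist T.root x + 1} from hw) ⟨hy, hwy⟩
  choose f hf hfP using step
  let g : ℕ → {x : V // P x} := fun n =>
    Nat.rec ⟨T.root, hroot⟩ (fun _ x => ⟨f x.1 x.2, hfP x.1 x.2⟩) n
  have hd : ∀ n, T.graph.dist T.root (g n).1 = n := by
    intro n
    induction n with
    | zero => simp [g]
    | succ n ih =>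
      have h := (hf (g n).1 (g n).2).2
      rw [ih] at h
      exact h
  have hray : T.IsRay fun n => (g n).1 :=
    ⟨rfl, fun n => (hf (g n).1 (g n).2).1, fun m n hmn => by
      have h := congrArg (T.graph.dist T.root) hmn
      simpa [hd] using h⟩
  obtain ⟨n, hn⟩ := C.meets _ hray
  obtain ⟨y, hy, hny⟩ := (g n).2.nonempty
  exact hy _ hn hny

/-- The inside `Cⁱ` of a cutset: the (finite) component of the root in the tree minus `C`. -/
def inside (C : T.Cutset) : Finset V := C.insideSet_finite.toFinset

open Classical in
/-- The vertices of `Cⁱ` in the subtree of descendants of `v` (including `v`). -/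
def insideAbove (C : T.Cutset) (v : V) : Finset V := C.inside.filter (T.Below v)

open Classical in
/-- `C(v)`: the vertices of `C` in the subtree of descendants of `v`. -/
def carrierAbove (C : T.Cutset) (v : V) : Finset V := C.carrier.filter (T.Below v)

theorem mem_insideAbove (C : T.Cutset) {v : V} (hv : v ∈ C.inside) : v ∈ C.insideAbove v := by
  classical
  exact Finset.mem_filter.2 ⟨hv, T.below_refl v⟩

theorem mem_of_mem_carrierAbove (C : T.Cutset) {v x : V} (hx : x ∈ C.carrierAbove v) :
    x ∈ C.carrier := by
  classical
  exact (Finset.mem_filter.1 hx).1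

end Cutset

/-- The sequence of cutsets approaches infinity: every vertex is eventually inside. -/
def ApproachesInfinity (C : ℕ → T.Cutset) : Prop := ∀ v : V, ∀ᶠ n in atTop, v ∈ (C n).inside

end BoundedRootedTree

/-- An energy function on a metric space: nonconstant, symmetric, continuous, and depending on its
arguments only through their distance. -/
structure EnergyFunction (S : Type*) [MetricSpace S] where
  toFun : S → S → ℝ
  symm : ∀ x y, toFun x y = toFun y x
  continuous : Continuous fun p : S × S => toFun p.1 p.2
  dist_invariant : ∀ x y x' y', dist x y = dist x' y' → toFun x y = toFun x' y'
  nonconstant : ∃ x y x' y', toFun x y ≠ toFun x' y'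

section Gibbs

variable {V S : Type*} [MetricSpace S] [MeasurableSpace S]

open Classical in
/-- The energy of a configuration `η` on the finite vertex set `L` with boundary condition `δ` on
the finite vertex set `D`: the sum of `J e * H (η x) (η y)` over the edges `e = xy` inside `L`
(the double sum over ordered pairs meets each such edge twice, whence the factor `1 / 2`), plus the
sum of `J e * H (η x) (δ y)` over the edges `e = xy` with `x` in `L` and `y` in `D`. -/
def hamiltonian (Γ : SimpleGraph V) (H : EnergyFunction S) (J : Sym2 V → ℝ≥0)
    (L D : Finset V) (δ : D → S) (η : L → S) : ℝ :=
  (1 / 2 : ℝ) * (∑ x : L, ∑ y : L,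
      if Γ.Adj x y then (J s(x.1, y.1) : ℝ) * H.toFun (η x) (η y) else 0)
    + ∑ x : L, ∑ y : D,
      if Γ.Adj x y then (J s(x.1, y.1) : ℝ) * H.toFun (η x) (δ y) else 0

/-- The Gibbs measure on configurations on `L` with boundary condition `δ` on `D`: its density with
respect to the product measure is `exp (-energy) / Z`, `Z` being the normalization. -/
def gibbsMeasure (Γ : SimpleGraph V) (H : EnergyFunction S) (J : Sym2 V → ℝ≥0) (dx : Measure S)
    (L D : Finset V) (δ : D → S) : Measure (L → S) :=
  (Measure.pi fun _ : L => dx).withDensity fun η =>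
    ENNReal.ofReal (Real.exp (-hamiltonian Γ H J L D δ η) /
      ∫ η', Real.exp (-hamiltonian Γ H J L D δ η') ∂(Measure.pi fun _ : L => dx))

variable (T : BoundedRootedTree V) (H : EnergyFunction S) (J : Sym2 V → ℝ≥0) (dx : Measure S)

/-- A Gibbs state: a probability measure `μ` on configurations on the whole tree such that, for each
cutset `C`, the conditional distribution of the configuration on `Cⁱ` given the configuration on the
complement of `Cⁱ` is the Gibbs measure on `Cⁱ` whose boundary condition is the restriction to `C`
of the latter. -/
def IsGibbsState (μ : Measure (V → S)) : Prop :=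
  IsProbabilityMeasure μ ∧
  ∀ (C : T.Cutset) (A : Set (C.inside → S)) (B : Set ({x : V // x ∉ C.inside} → S)),
    MeasurableSet A → MeasurableSet B →
      μ {η | (fun x : C.inside => η x) ∈ A ∧ (fun x : {x : V // x ∉ C.inside} => η x) ∈ B} =
        ∫⁻ η in {η : V → S | (fun x : {x : V // x ∉ C.inside} => η x) ∈ B},
          gibbsMeasure T.graph H J dx C.inside C.carrier (fun y => η y) A ∂μ

/-- Phase transition: there is more than one Gibbs state. -/
def PhaseTransition : Prop :=
  ∃ μ ν : Measure (V → S), IsGibbsState T H J dx μ ∧ IsGibbsState T H J dx ν ∧ μ ≠ ν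

/-- Symmetry breaking: some Gibbs state has at some vertex a marginal distribution that is not
invariant under the group `G`. -/
def SymmetryBreaking (G : Type*) [Group G] [MulAction G S] : Prop :=
  ∃ μ : Measure (V → S), IsGibbsState T H J dx μ ∧
    ∃ v : V, ¬ SMulInvariantMeasure G S (μ.map fun η => η v)

/-- The density with respect to `dx` of the marginal at `v` of the Gibbs measure, with boundary
condition `δ` restricted to `C(v)`, on the part of `Cⁱ` in the subtree of descendants of `v`.
(The rest of the tree plays no role.) -/
def marginalDensity {T : BoundedRootedTree V} (C : T.Cutset) (δ : C.carrier → S) (v : V)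
    (hv : v ∈ C.inside) : S → ℝ := fun s =>
  (((gibbsMeasure T.graph H J dx (C.insideAbove v) (C.carrierAbove v)
      (fun y => δ ⟨y.1, C.mem_of_mem_carrierAbove y.2⟩)).map
    (fun η => η ⟨v, C.mem_insideAbove hv⟩)).rnDeriv dx s).toReal

/-- The infimum over `n` of the sup norm of the marginal density at `v` minus one. It runs over
those `n` (all large ones, when the cutsets approach infinity) for which `v` is inside the `n`-th
cutset, since the density is defined only for them. -/
def infDeviation {T : BoundedRootedTree V} (C : ℕ → T.Cutset) (δ : ∀ n, (C n).carrier → S) (v : V) :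
    ℝ≥0∞ :=
  ⨅ (n : ℕ) (hv : v ∈ (C n).inside),
    eLpNorm (fun s => marginalDensity H J dx (C n) (δ n) v hv s - 1) ∞ dx

end Gibbs

end

/-! Orienting every edge from parent to child turns an energy into a sum over child vertices, and
the Gibbs measure of a cutset into a kernel `resample` that redraws finitely many spins with density
proportional to a product of edge factors. All four implications are statements about these kernels.

(i) implies (ii) because the spheres around the root are cutsets tending to infinity.

(ii) implies (iii): keep the given boundary conditions above `v` and drop the edges to the rest of
the cutset. The integral over the spins that are not above `v` is then a function of the spin at `v`
alone, invariant under the transitive group, hence constant; so the law at `v` is the one computed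
in the subtree (`map_eval_resample_inside_eq`). A weak limit exists by compactness and is a Gibbs
state, since the kernels preserve continuity (`bind_resample_eq_of_tendsto`). If its marginal at `v`
were invariant it would be `dx` (`eq_of_smulInvariantMeasure`). Weak convergence of marginals would
not contradict a deviation in sup norm, but the density at `v` is the average of the jointly
continuous conditional density `siteDensity`, so the densities converge uniformly
(`eventually_forall_abs_integral_sub_le`) and the infimum would vanish.

(iii) implies (iv) because the group maps Gibbs states to Gibbs states (`IsGibbsState.map_smul`), so
a unique one is invariant.

(iv) implies (i), by contraposition: if (i) fails, each vertex `w` has a cutset for which all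
densities at `w` are uniformly close to one. Gluing such cutsets along a sphere makes the law in the
ball inside it almost independent of the boundary condition: on a tree the ball interacts with each
branch only through one edge, whose averaged factor is nearly the free one (`resample_inside_le`).
Letting the error tend to zero with the ball fixed determines every Gibbs state on every ball
(`not_phaseTransition_of_nearlyFree`). -/

noncomputable section

/-! ### Rooted trees: parents, the ancestor order, balls and spheres. -/

namespace BoundedRootedTree

open Classical in
/-- The parent of a vertex; the root is its own parent. -/
def parent {V : Type*} (T : BoundedRootedTree V) (y : V) : V :=
  if h : ∃ p, T.graph.Adj p y ∧ T.graph.dist T.root y = T.graph.dist T.root p + 1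
  then h.choose else y

section Tree

variable {V : Type*} (T : BoundedRootedTree V)

/-- By acyclicity, a neighbour of `x` closer to the root must be the last vertex before `x` on the
unique path from the root. -/
theorem eq_of_adj_of_dist {p q x : V} (hp : T.graph.Adj p x)
    (hpd : T.graph.dist T.root x = T.graph.dist T.root p + 1) (hq : T.graph.Adj q x)
    (hqd : T.graph.dist T.root x = T.graph.dist T.root q + 1) : p = q := by
  classical
  have hA := T.isTree.isAcyclic
  obtain ⟨P, hP, -⟩ := (T.isTree.connected T.root x).exists_path_of_dist
  have key : ∀ p, T.graph.Adj p x → T.graph.dist T.root x = T.graph.dist T.root p + 1 →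
      p = P.penultimate := by
    intro p hp hpd
    obtain ⟨Q, hQ, hQl⟩ := (T.isTree.connected T.root p).exists_path_of_dist
    refine hA.eq_penultimate_of_adj_end hP hp.symm
      (hA.mem_support_of_ne_mem_support_of_adj_of_isPath hP hQ hp.symm fun hx => ?_)
    have h1 := SimpleGraph.dist_le (Q.takeUntil x hx)
    have h2 := Q.length_takeUntil_le_length hx
    omega
  rw [key p hp hpd, key q hq hqd]

theorem dist_root_of_adj {x y : V} (h : T.graph.Adj x y) :
    T.graph.dist T.root x = T.graph.dist T.root y + 1 ∨
      T.graph.dist T.root y = T.graph.dist T.root x + 1 :=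
  T.isTree.dist_eq_dist_add_one_of_adj T.root h

theorem dist_pos_of_ne {x y : V} (h : x ≠ y) : 0 < T.graph.dist x y :=
  T.isTree.connected.pos_dist_of_ne h

theorem parent_spec {y : V} (hy : y ≠ T.root) : T.graph.Adj (T.parent y) y ∧
    T.graph.dist T.root y = T.graph.dist T.root (T.parent y) + 1 := by
  have h : ∃ p, T.graph.Adj p y ∧ T.graph.dist T.root y = T.graph.dist T.root p + 1 := by
    obtain ⟨P, hP⟩ := T.isTree.connected.exists_walk_length_eq_dist y T.root
    cases P with
    | nil => exact absurd rfl hy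
    | @cons _ w _ hadj q =>
      refine ⟨w, hadj.symm, ?_⟩
      have h1 := SimpleGraph.dist_le q
      rw [SimpleGraph.Walk.length_cons, SimpleGraph.dist_comm] at hP
      rw [SimpleGraph.dist_comm] at h1
      rcases T.dist_root_of_adj hadj with h | h <;> omega
  rw [parent, dif_pos h]
  exact h.choose_spec

theorem parent_root : T.parent T.root = T.root := by
  rw [parent, dif_neg]
  rintro ⟨p, -, h⟩
  simp at h

theorem eq_parent {p y : V} (h : T.graph.Adj p y)
    (hd : T.graph.dist T.root y = T.graph.dist T.root p + 1) : p = T.parent y := by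
  have hy : y ≠ T.root := by rintro rfl; simp at hd
  exact T.eq_of_adj_of_dist h hd (T.parent_spec hy).1 (T.parent_spec hy).2

/-- Distances to the root differ by one along an edge, so each edge is named by its child endpoint.
This is what lets energies be indexed by vertices. -/
theorem adj_iff {x y : V} : T.graph.Adj x y ↔
    (y ≠ T.root ∧ x = T.parent y) ∨ (x ≠ T.root ∧ y = T.parent x) := by
  constructor
  · intro h
    rcases T.dist_root_of_adj h with hd | hd
    · exact Or.inr ⟨by rintro rfl; simp at hd, T.eq_parent h.symm hd⟩
    · exact Or.inl ⟨by rintro rfl; simp at hd, T.eq_parent h hd⟩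
  · rintro (⟨h, rfl⟩ | ⟨h, rfl⟩)
    · exact (T.parent_spec h).1
    · exact (T.parent_spec h).1.symm

variable {T}

theorem Below.trans {x y z : V} (h1 : T.Below x y) (h2 : T.Below y z) : T.Below x z := by
  have h3 := T.isTree.connected.dist_triangle (u := x) (v := y) (w := z)
  have h4 := T.isTree.connected.dist_triangle (u := T.root) (v := x) (w := z)
  unfold Below at *
  omega

theorem Below.dist_le {x y : V} (h : T.Below x y) :
    T.graph.dist T.root x ≤ T.graph.dist T.root y := by
  unfold Below at h; omega

theorem Below.eq_of_dist_le {x y : V} (h : T.Below x y)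
    (hd : T.graph.dist T.root y ≤ T.graph.dist T.root x) : x = y := by
  by_contra hne
  have := T.dist_pos_of_ne hne
  unfold Below at h; omega

theorem eq_root_of_below_root {x : V} (h : T.Below x T.root) : x = T.root :=
  h.eq_of_dist_le (by simp)

theorem parent_below (y : V) : T.Below (T.parent y) y := by
  by_cases hy : y = T.root
  · subst hy; rw [T.parent_root]; exact T.below_refl _
  · obtain ⟨h1, h2⟩ := T.parent_spec hy
    have := SimpleGraph.dist_eq_one_iff_adj.2 h1
    unfold Below; omega

theorem Below.below_parent {x y : V} (h : T.Below x y) (hne : x ≠ y) :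
    T.Below x (T.parent y) := by
  have hc := T.isTree.connected
  obtain ⟨P, hP⟩ := hc.exists_walk_length_eq_dist y x
  cases P with
  | nil => exact absurd rfl hne
  | @cons _ w _ hadj q =>
    have h1 := SimpleGraph.dist_le q
    rw [SimpleGraph.Walk.length_cons, SimpleGraph.dist_comm] at hP
    rw [SimpleGraph.dist_comm] at h1
    have h2 := hc.dist_triangle (u := T.root) (v := x) (w := w)
    have h3 : T.graph.dist T.root y = T.graph.dist T.root w + 1 := by
      unfold Below at h
      rcases T.dist_root_of_adj hadj with h | h <;> omega
    rw [← T.eq_parent hadj.symm h3]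
    unfold Below at *
    omega

/-- The ancestors of a vertex form a chain: unless `a` or `b` is `x` itself, both are ancestors of
the parent of `x`, and the depth drops. -/
theorem Below.total {a b x : V} (ha : T.Below a x) (hb : T.Below b x) :
    T.Below a b ∨ T.Below b a := by
  induction hn : T.graph.dist T.root x generalizing x with
  | zero =>
    have hx : x = T.root := by
      by_contra hne
      have := T.dist_pos_of_ne (Ne.symm hne)
      omega
    subst hx
    rw [eq_root_of_below_root ha, eq_root_of_below_root hb]
    exact Or.inl (T.below_refl _)
  | succ n ih =>
    by_cases hax : a = x
    · subst hax; exact Or.inr hb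
    by_cases hbx : b = x
    · subst hbx; exact Or.inl ha
    have hx : x ≠ T.root := by rintro rfl; simp at hn
    have := (T.parent_spec hx).2
    exact ih (ha.below_parent hax) (hb.below_parent hbx) (by omega)

theorem Below.eq_of_dist_eq {a b x : V} (ha : T.Below a x) (hb : T.Below b x)
    (h : T.graph.dist T.root a = T.graph.dist T.root b) : a = b := by
  rcases ha.total hb with h' | h'
  · exact h'.eq_of_dist_le h.ge
  · exact (h'.eq_of_dist_le h.le).symm

theorem exists_below_dist_eq {x : V} {n : ℕ} (h : n ≤ T.graph.dist T.root x) :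
    ∃ w, T.Below w x ∧ T.graph.dist T.root w = n := by
  induction hk : T.graph.dist T.root x generalizing x with
  | zero => exact ⟨x, T.below_refl x, by omega⟩
  | succ k ih =>
    by_cases hn : n = k + 1
    · exact ⟨x, T.below_refl x, by omega⟩
    have hx : x ≠ T.root := by rintro rfl; simp at hk
    have := (T.parent_spec hx).2
    obtain ⟨w, hw, hwn⟩ := ih (x := T.parent x) (by omega) (by omega)
    exact ⟨w, hw.trans (parent_below x), hwn⟩

variable (T)

theorem finite_children (x : V) : {y : V | T.graph.Adj x y ∧
    T.graph.dist T.root y = T.graph.dist T.root x + 1}.Finite := by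
  obtain ⟨B, hB⟩ := T.bounded_children
  exact Set.finite_of_encard_le_coe (hB x)

theorem finite_sphere (n : ℕ) : {x : V | T.graph.dist T.root x = n}.Finite := by
  induction n with
  | zero =>
    refine (Set.finite_singleton T.root).subset fun x hx => ?_
    by_contra hne
    have := T.dist_pos_of_ne (Ne.symm hne)
    exact this.ne' hx
  | succ n ih =>
    refine (ih.biUnion fun x _ => T.finite_children x).subset fun y hy => ?_
    have hy' : T.graph.dist T.root y = n + 1 := hy
    have hyr : y ≠ T.root := by rintro rfl; simp at hy'
    obtain ⟨h1, h2⟩ := T.parent_spec hyr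
    exact Set.mem_biUnion (show T.graph.dist T.root (T.parent y) = n by omega) ⟨h1, h2⟩

/-- The vertices at distance `n` from the root. -/
def sphere (n : ℕ) : Finset V := (T.finite_sphere n).toFinset

theorem finite_ball (n : ℕ) : {x : V | T.graph.dist T.root x ≤ n}.Finite := by
  refine ((Set.finite_Iic n).biUnion fun k _ => T.finite_sphere k).subset fun x hx => ?_
  exact Set.mem_biUnion (show T.graph.dist T.root x ∈ Set.Iic n from hx) rfl

/-- The vertices at distance at most `n` from the root. -/
def ball (n : ℕ) : Finset V := (T.finite_ball n).toFinset

variable {T}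

@[simp] theorem mem_sphere {n : ℕ} {x : V} : x ∈ T.sphere n ↔ T.graph.dist T.root x = n := by
  simp [sphere]

@[simp] theorem mem_ball {n : ℕ} {x : V} : x ∈ T.ball n ↔ T.graph.dist T.root x ≤ n := by
  simp [ball]

theorem countable_vertices {V : Type*} (T : BoundedRootedTree V) : Countable V := by
  refine Set.countable_univ_iff.1 ?_
  have : (Set.univ : Set V) = ⋃ n, {x : V | T.graph.dist T.root x = n} := by ext x; simp
  rw [this]
  exact Set.countable_iUnion fun n => (T.finite_sphere n).countable

theorem finite_neighbors (v : V) : {y : V | y = v ∨ T.parent y = v}.Finite := by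
  refine (((Set.finite_singleton v).union (T.finite_children v)).union
    (Set.finite_singleton T.root)).subset ?_
  rintro y (rfl | hy)
  · exact Or.inl (Or.inl rfl)
  · by_cases hr : y = T.root
    · exact Or.inr hr
    · subst hy; exact Or.inl (Or.inr (T.parent_spec hr))

variable (T) in
/-- The vertex `v` together with its children. -/
def star (v : V) : Finset V := (finite_neighbors (T := T) v).toFinset

theorem mem_star {v y : V} : y ∈ T.star v ↔ y = v ∨ T.parent y = v := by
  simp [star]

/-- A step back toward the root would go to the unique parent, which is the vertex just visited;
self-avoidance forbids it. -/
theorem IsRay.dist_root {γ : ℕ → V} (h : T.IsRay γ) (n : ℕ) : T.graph.dist T.root (γ n) = n := by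
  induction n using Nat.strong_induction_on with
  | _ n ih =>
    match n with
    | 0 => simp [h.start]
    | 1 =>
      have := h.adj 0
      rw [h.start] at this
      exact SimpleGraph.dist_eq_one_iff_adj.2 this
    | n + 2 =>
      have h0 := ih n (by omega)
      have h1 := ih (n + 1) (by omega)
      rcases T.dist_root_of_adj (h.adj (n + 1)) with hd | hd
      · have := T.eq_of_adj_of_dist (h.adj n) (by omega) (h.adj (n + 1)).symm hd
        exact absurd (h.injective this) (by omega)
      · rw [hd, h1]

theorem IsRay.below {γ : ℕ → V} (h : T.IsRay γ) {m n : ℕ} (hmn : m ≤ n) :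
    T.Below (γ m) (γ n) := by
  induction n, hmn using Nat.le_induction with
  | base => exact T.below_refl _
  | succ n _ ih =>
    have : γ n = T.parent (γ (n + 1)) :=
      T.eq_parent (h.adj n) (by rw [h.dist_root, h.dist_root])
    exact ih.trans (this ▸ parent_below _)

/-! ### Cutsets: boundary structure, spheres, and gluing along a sphere. -/

namespace Cutset

variable (C : T.Cutset)

theorem mem_inside {x : V} : x ∈ C.inside ↔ ∀ c ∈ C.carrier, ¬ T.Below c x := by
  simp [inside, insideSet]

theorem mem_insideAbove_iff {v x : V} : x ∈ C.insideAbove v ↔ x ∈ C.inside ∧ T.Below v x := by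
  simp [insideAbove]

theorem mem_carrierAbove_iff {v x : V} :
    x ∈ C.carrierAbove v ↔ x ∈ C.carrier ∧ T.Below v x := by
  simp [carrierAbove]

theorem mem_inside_of_below {x y : V} (hy : y ∈ C.inside) (h : T.Below x y) : x ∈ C.inside := by
  rw [mem_inside] at *
  exact fun c hc hcx => hy c hc (hcx.trans h)

theorem root_mem_inside : T.root ∈ C.inside := by
  rw [mem_inside]
  intro c hc h
  exact C.root_notMem (eq_root_of_below_root h ▸ hc)

theorem notMem_carrier {x : V} (hx : x ∈ C.inside) : x ∉ C.carrier := fun h =>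
  C.mem_inside.1 hx x h (T.below_refl x)

theorem ne_root_of_mem_carrier {c : V} (hc : c ∈ C.carrier) : c ≠ T.root := by
  rintro rfl; exact C.root_notMem hc

/-- A cutset vertex weakly above the root and below the parent of `c` would also be below `c`, hence
equal to `c` by the antichain property, against the depths. -/
theorem parent_mem_inside {c : V} (hc : c ∈ C.carrier) : T.parent c ∈ C.inside := by
  rw [mem_inside]
  intro c' hc' h
  have h1 := C.antichain c' hc' c hc (h.trans (parent_below c))
  subst h1
  have h2 := h.dist_le
  have h3 := (T.parent_spec (C.ne_root_of_mem_carrier hc)).2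
  omega

theorem mem_inside_or_mem_carrier {x : V} (hx : T.parent x ∈ C.inside) :
    x ∈ C.inside ∨ x ∈ C.carrier := by
  by_contra h
  push Not at h
  obtain ⟨h1, h2⟩ := h
  rw [mem_inside] at h1 hx
  push Not at h1
  obtain ⟨c, hc, hcx⟩ := h1
  refine hx c hc (hcx.below_parent ?_)
  rintro rfl
  exact h2 hc

end Cutset

variable (T) in
/-- The sphere of radius `n + 1` as a cutset. -/
def sphereCutset (n : ℕ) : T.Cutset where
  carrier := T.sphere (n + 1)
  root_notMem := by simp
  meets γ h := ⟨n + 1, by simp [h.dist_root]⟩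
  antichain x hx y hy h := by
    rw [mem_sphere] at hx hy
    exact h.eq_of_dist_le (by omega)

variable (T) in
theorem approachesInfinity_sphereCutset : ApproachesInfinity T.sphereCutset := by
  intro v
  filter_upwards [eventually_ge_atTop (T.graph.dist T.root v)] with n hn
  rw [Cutset.mem_inside]
  intro c hc h
  have h1 : T.graph.dist T.root c = n + 1 := mem_sphere.1 hc
  have := h.dist_le
  omega

theorem ApproachesInfinity.eventually_subset {C : ℕ → T.Cutset} (h : ApproachesInfinity C)
    (U : Finset V) : ∀ᶠ n in atTop, U ⊆ (C n).inside :=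
  (U.eventually_all (l := atTop)).2 fun v _ => h v

section Glue

variable [DecidableEq V] (n : ℕ) (C : V → T.Cutset) (hC : ∀ w ∈ T.sphere (n + 1), w ∈ (C w).inside)

/-- The cutset that agrees with `C w` above each vertex `w` of the sphere of radius `n + 1`. -/
def glueCutset : T.Cutset where
  carrier := (T.sphere (n + 1)).biUnion fun w => (C w).carrierAbove w
  root_notMem h := by
    obtain ⟨w, hw, h⟩ := Finset.mem_biUnion.1 h
    rw [Cutset.mem_carrierAbove_iff] at h
    have := eq_root_of_below_root h.2
    subst this
    simp at hw
  meets γ h := by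
    have hw : γ (n + 1) ∈ T.sphere (n + 1) := by simp [h.dist_root]
    obtain ⟨m, hm⟩ := (C (γ (n + 1))).meets γ h
    refine ⟨m, Finset.mem_biUnion.2 ⟨_, hw, ((C _).mem_carrierAbove_iff).2 ⟨hm, ?_⟩⟩⟩
    rcases le_total m (n + 1) with hmn | hmn
    · exact absurd (h.below hmn) ((Cutset.mem_inside _).1 (hC _ hw) _ hm)
    · exact h.below hmn
  antichain x hx y hy h := by
    obtain ⟨w, hw, hx⟩ := Finset.mem_biUnion.1 hx
    obtain ⟨w', hw', hy⟩ := Finset.mem_biUnion.1 hy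
    rw [Cutset.mem_carrierAbove_iff] at hx hy
    rw [mem_sphere] at hw hw'
    have : w = w' := (hx.2.trans h).eq_of_dist_eq hy.2 (by omega)
    subst this
    exact (C w).antichain x hx.1 y hy.1 h

theorem carrierAbove_glueCutset {w : V} (hw : w ∈ T.sphere (n + 1)) :
    (glueCutset n C hC).carrierAbove w = (C w).carrierAbove w := by
  ext x
  simp only [Cutset.mem_carrierAbove_iff, glueCutset, Finset.mem_biUnion]
  constructor
  · rintro ⟨⟨w', hw', h1, h2⟩, h3⟩
    rw [mem_sphere] at hw hw'
    have : w' = w := h2.eq_of_dist_eq h3 (by omega)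
    subst this
    exact ⟨h1, h3⟩
  · exact fun h => ⟨⟨w, hw, h⟩, h.2⟩

/-- Since `w` is inside `C w`, a vertex of `C w` that blocks some descendant of `w` must itself
descend from `w`; such vertices are kept by the gluing. -/
theorem insideAbove_glueCutset {w : V} (hw : w ∈ T.sphere (n + 1)) :
    (glueCutset n C hC).insideAbove w = (C w).insideAbove w := by
  ext x
  simp only [Cutset.mem_insideAbove_iff, Cutset.mem_inside]
  refine and_congr_left fun hwx => ⟨fun h c hc hcx => ?_, fun h c hc hcx => ?_⟩
  · rcases hcx.total hwx with h1 | h1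
    · exact (Cutset.mem_inside _).1 (hC w hw) c hc h1
    · exact h c (Finset.mem_biUnion.2 ⟨w, hw, ((C w).mem_carrierAbove_iff).2 ⟨hc, h1⟩⟩) hcx
  · obtain ⟨w', hw', hc⟩ := Finset.mem_biUnion.1 hc
    rw [Cutset.mem_carrierAbove_iff] at hc
    rw [mem_sphere] at hw hw'
    have : w' = w := (hc.2.trans hcx).eq_of_dist_eq hwx (by omega)
    subst this
    exact h c hc.1 hcx

theorem ball_subset_inside_glueCutset : T.ball n ⊆ (glueCutset n C hC).inside := by
  intro x hx
  rw [Cutset.mem_inside]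
  intro c hc hcx
  obtain ⟨w, hw, hc⟩ := Finset.mem_biUnion.1 hc
  rw [Cutset.mem_carrierAbove_iff] at hc
  rw [mem_sphere] at hw
  rw [mem_ball] at hx
  have h1 := hc.2.dist_le
  have h2 := hcx.dist_le
  omega

theorem mem_inside_of_sphere {w : V} (hw : w ∈ T.sphere (n + 1)) :
    w ∈ (glueCutset n C hC).inside := by
  have : w ∈ (glueCutset n C hC).insideAbove w := by
    rw [insideAbove_glueCutset n C hC hw]
    exact (C w).mem_insideAbove (hC w hw)
  exact ((Cutset.mem_insideAbove_iff _).1 this).1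

end Glue

end Tree

end BoundedRootedTree

/-! ### Partial integrals of functions of finitely many blocks of spins. -/

section DependsOn

variable {V S : Type*}

theorem DependsOn.mul {f g : (V → S) → ℝ≥0∞} {s : Set V} (hf : DependsOn f s)
    (hg : DependsOn g s) : DependsOn (f * g) s := fun x y h => by
  simp only [Pi.mul_apply, hf h, hg h]

theorem DependsOn.finset_prod {ι M : Type*} [CommMonoid M] {f : ι → (V → S) → M} {A : Finset ι}
    {s : Set V} (hf : ∀ i ∈ A, DependsOn (f i) s) : DependsOn (∏ i ∈ A, f i) s := fun x y h => by
  simp only [Finset.prod_apply]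
  exact Finset.prod_congr rfl fun i hi => hf i hi h

theorem DependsOn.compl_biUnion {ι M : Type*} [DecidableEq V] [DecidableEq ι] {f : (V → S) → M}
    {A : Finset ι} {L : ι → Finset V} (hf : ∀ i ∈ A, DependsOn f (L i : Set V)ᶜ) :
    DependsOn f ((A.biUnion L : Finset V) : Set V)ᶜ := by
  induction A using Finset.induction_on with
  | empty => simpa using dependsOn_univ f
  | insert c A hc ih =>
    intro x y h
    -- Overwriting the block `L c` of `x` by `y` does not change `f`, and leaves disagreement only
    -- on the other blocks.
    have h1 : f x = f (Function.updateFinset x (L c) fun i => y i) :=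
      hf c (Finset.mem_insert_self c A) fun i hi => by
        simp only [Function.updateFinset]; rw [dif_neg (by exact hi)]
    rw [h1]
    refine ih (fun i hi => hf i (Finset.mem_insert_of_mem hi)) fun i hi => ?_
    by_cases hic : i ∈ L c
    · simp [Function.updateFinset, hic]
    · simp only [Function.updateFinset, hic, dite_false]
      refine h i ?_
      rw [Set.mem_compl_iff, Finset.mem_coe] at hi ⊢
      simp only [Finset.biUnion_insert, Finset.mem_union]
      tauto

end DependsOn

section Marginal

variable {V S : Type*} [DecidableEq V] [MeasurableSpace S] (dx : Measure S)

theorem lmarginal_mul_of_dependsOn {L : Finset V} {g f : (V → S) → ℝ≥0∞}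
    (hg : DependsOn g (L : Set V)ᶜ) (hf : Measurable f) :
    lmarginal (fun _ => dx) L (g * f) = g * lmarginal (fun _ => dx) L f := by
  ext η
  have h : ∀ ξ, g (Function.updateFinset η L ξ) = g η := fun ξ =>
    hg fun i hi => by simp only [Function.updateFinset]; rw [dif_neg (by exact hi)]
  simp only [lmarginal, Pi.mul_apply, h]
  exact lintegral_const_mul _ (hf.comp measurable_updateFinset)

theorem dependsOn_lmarginal {L : Finset V} {f : (V → S) → ℝ≥0∞} {s : Set V}
    (hf : DependsOn f s) : DependsOn (lmarginal (fun _ => dx) L f) (s \ L) := by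
  intro x y h
  refine lintegral_congr fun ξ => hf fun i hi => ?_
  by_cases hiL : i ∈ L
  · simp [Function.updateFinset, hiL]
  · simp [Function.updateFinset, hiL, h i ⟨hi, hiL⟩]

theorem dependsOn_lmarginal_compl (L : Finset V) (f : (V → S) → ℝ≥0∞) :
    DependsOn (lmarginal (fun _ => dx) L f) (L : Set V)ᶜ := by
  have := dependsOn_lmarginal dx (L := L) (dependsOn_univ f)
  rwa [← Set.compl_eq_univ_sdiff] at this

variable [IsProbabilityMeasure dx]

theorem lmarginal_const_eq (L : Finset V) (c : ℝ≥0∞) (η : V → S) :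
    lmarginal (fun _ => dx) L (fun _ => c) η = c := by
  simp [lmarginal]

/-- The integral of a product of functions depending on disjoint blocks of variables is the product
of the integrals. -/
theorem lmarginal_biUnion_prod {ι : Type*} [DecidableEq ι] (A : Finset ι) (L : ι → Finset V)
    (f : ι → (V → S) → ℝ≥0∞) (hf : ∀ i ∈ A, Measurable (f i))
    (hL : ∀ i ∈ A, ∀ j ∈ A, i ≠ j → Disjoint (L i) (L j))
    (hfL : ∀ i ∈ A, ∀ j ∈ A, i ≠ j → DependsOn (f i) (L j : Set V)ᶜ) :
    lmarginal (fun _ => dx) (A.biUnion L) (∏ i ∈ A, f i) =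
      ∏ i ∈ A, lmarginal (fun _ => dx) (L i) (f i) := by
  induction A using Finset.induction_on with
  | empty => simp
  | insert a A ha ih =>
    have hne : ∀ i ∈ A, i ≠ a := fun i hi h => ha (h ▸ hi)
    have hA : ∀ i ∈ A, i ∈ insert a A := fun i hi => Finset.mem_insert_of_mem hi
    have haA := Finset.mem_insert_self a A
    have hmA : Measurable (∏ i ∈ A, f i) := by
      rw [Finset.prod_fn]
      exact Finset.measurable_prod _ fun i hi => hf i (hA i hi)
    have hma := hf a haA
    rw [Finset.prod_insert ha, Finset.prod_insert ha, Finset.biUnion_insert, Finset.union_comm,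
      lmarginal_union _ _ (hma.mul hmA), mul_comm (f a),
      lmarginal_mul_of_dependsOn dx (DependsOn.finset_prod fun i hi =>
        hfL i (hA i hi) a haA (hne i hi)) hma, mul_comm (∏ i ∈ A, f i),
      lmarginal_mul_of_dependsOn dx _ hmA,
      ih (fun i hi => hf i (hA i hi)) (fun i hi j hj => hL i (hA i hi) j (hA j hj))
        (fun i hi j hj => hfL i (hA i hi) j (hA j hj))]
    · exact (dependsOn_lmarginal dx (DependsOn.compl_biUnion fun i hi =>
        hfL a haA i (hA i hi) (hne i hi).symm)).mono Set.sdiff_subset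
    · refine (Finset.disjoint_biUnion_left _ _ _).2 fun i hi => ?_
      exact hL i (hA i hi) a haA (hne i hi)

theorem lmarginal_smul {G : Type*} [Group G] [MulAction G S] [MeasurableConstSMul G S]
    [SMulInvariantMeasure G S dx] (L : Finset V) {f : (V → S) → ℝ≥0∞} (hf : Measurable f) (g : G)
    (η : V → S) :
    lmarginal (fun _ => dx) L f (g • η) = lmarginal (fun _ => dx) L (fun η => f (g • η)) η := by
  have h := (measurePreserving_pi (fun _ : L => dx) (fun _ => dx)
    (fun _ => measurePreserving_smul g dx)).lintegral_comp
    (f := fun ξ => f (Function.updateFinset (g • η) L ξ)) (hf.comp measurable_updateFinset)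
  simp only [lmarginal]
  rw [← h]
  refine lintegral_congr fun ξ => congrArg f (funext fun i => ?_)
  by_cases hi : i ∈ L <;> simp [Function.updateFinset, hi]

end Marginal

/-! ### The resampling kernels: normalization, consistency, equivariance. -/

section Resample

variable {V S : Type*} [DecidableEq V] [MeasurableSpace S] (dx : Measure S)

/-- Resampling of the coordinates in `L` of the configuration `η`: the probability measure whose
density with respect to `dx` in the coordinates in `L` is proportional to `w`. -/
def resample (w : (V → S) → ℝ≥0) (L : Finset V) (η : V → S) : Measure (V → S) :=
  ((Measure.pi fun _ : L => dx).withDensity fun ξ =>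
    (w (Function.updateFinset η L ξ) : ℝ≥0∞) /
      lmarginal (fun _ => dx) L (fun η => (w η : ℝ≥0∞)) η).map (Function.updateFinset η L)

variable {w : (V → S) → ℝ≥0}

theorem lintegral_resample (hw : Measurable w) (L : Finset V) (η : V → S)
    {F : (V → S) → ℝ≥0∞} (hF : Measurable F) :
    ∫⁻ ζ, F ζ ∂resample dx w L η =
      lmarginal (fun _ => dx) L (F * fun η => (w η : ℝ≥0∞)) η /
        lmarginal (fun _ => dx) L (fun η => (w η : ℝ≥0∞)) η := by
  have h1 : Measurable fun ξ : L → S => (w (Function.updateFinset η L ξ) : ℝ≥0∞) :=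
    (hw.comp measurable_updateFinset).coe_nnreal_ennreal
  have h2 : Measurable fun ξ : L → S => F (Function.updateFinset η L ξ) :=
    hF.comp measurable_updateFinset
  rw [resample, lintegral_map hF measurable_updateFinset,
    lintegral_withDensity_eq_lintegral_mul _ (h1.div_const _) h2, ENNReal.div_eq_inv_mul]
  have h3 := lintegral_const_mul (μ := Measure.pi fun _ : L => dx)
    (lmarginal (fun _ => dx) L (fun η => (w η : ℝ≥0∞)) η)⁻¹ (h2.mul h1)
  refine Eq.trans ?_ h3
  refine lintegral_congr fun ξ => ?_
  simp only [Pi.mul_apply, ENNReal.div_eq_inv_mul]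
  ring

/-- Resampling depends only on the coordinates that it keeps. -/
theorem dependsOn_lintegral_resample (hw : Measurable w) (L : Finset V) {F : (V → S) → ℝ≥0∞}
    (hF : Measurable F) : DependsOn (fun η => ∫⁻ ζ, F ζ ∂resample dx w L η) (L : Set V)ᶜ := by
  intro x y h
  simp only [lintegral_resample dx hw L _ hF]
  rw [dependsOn_lmarginal_compl dx L _ h, dependsOn_lmarginal_compl dx L (fun η => (w η : ℝ≥0∞)) h]

variable [IsProbabilityMeasure dx]

theorem measurable_resample (hw : Measurable w) (L : Finset V) :
    Measurable fun η => resample dx w L η := by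
  refine Measure.measurable_of_measurable_coe _ fun s hs => ?_
  have : (fun η => resample dx w L η s) = fun η =>
      lmarginal (fun _ => dx) L (s.indicator 1 * fun η => (w η : ℝ≥0∞)) η /
        lmarginal (fun _ => dx) L (fun η => (w η : ℝ≥0∞)) η := by
    ext η
    rw [← lintegral_resample dx hw L η (measurable_one.indicator hs), lintegral_indicator_one hs]
  rw [this]
  exact (((measurable_one.indicator hs).mul hw.coe_nnreal_ennreal).lmarginal _).div
    (hw.coe_nnreal_ennreal.lmarginal _)

theorem measurable_lintegral_resample (hw : Measurable w) (L : Finset V) {F : (V → S) → ℝ≥0∞}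
    (hF : Measurable F) : Measurable fun η => ∫⁻ ζ, F ζ ∂resample dx w L η :=
  (Measure.measurable_lintegral hF).comp (measurable_resample dx hw L)

variable [TopologicalSpace S] [CompactSpace S]

/-- Compactness of the configuration space bounds the weight between two positive constants. Every
later division by a partition function rests on this. -/
theorem lmarginal_weight_pos_lt_top (hc : Continuous w) (hpos : ∀ η, 0 < w η) (L : Finset V)
    (η : V → S) : 0 < lmarginal (fun _ => dx) L (fun η => (w η : ℝ≥0∞)) η ∧
      lmarginal (fun _ => dx) L (fun η => (w η : ℝ≥0∞)) η < ⊤ := by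
  have : Nonempty (V → S) := ⟨η⟩
  obtain ⟨a, -, ha⟩ := isCompact_univ.exists_isMinOn Set.univ_nonempty hc.continuousOn
  obtain ⟨b, -, hb⟩ := isCompact_univ.exists_isMaxOn Set.univ_nonempty hc.continuousOn
  constructor
  · refine lt_of_lt_of_le (ENNReal.coe_pos.2 (hpos a)) ?_
    rw [← lmarginal_const_eq dx L (w a) η]
    exact lmarginal_mono (fun ζ => ENNReal.coe_le_coe.2 (ha (Set.mem_univ ζ))) η
  · refine lt_of_le_of_lt ?_ (ENNReal.coe_lt_top (r := w b))
    rw [← lmarginal_const_eq dx L (w b) η]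
    exact lmarginal_mono (fun ζ => ENNReal.coe_le_coe.2 (hb (Set.mem_univ ζ))) η

theorem isProbabilityMeasure_resample (hw : Measurable w) (hc : Continuous w)
    (hpos : ∀ η, 0 < w η) (L : Finset V) (η : V → S) :
    IsProbabilityMeasure (resample dx w L η) := by
  obtain ⟨h1, h2⟩ := lmarginal_weight_pos_lt_top dx hc hpos L η
  constructor
  have h := lintegral_resample dx hw L η (measurable_const (a := (1 : ℝ≥0∞)))
  rw [lintegral_one] at h
  rw [h]
  have : ((fun _ => 1 : (V → S) → ℝ≥0∞) * fun η => (w η : ℝ≥0∞)) = fun η => (w η : ℝ≥0∞) := by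
    ext; simp
  rw [this, ENNReal.div_self h1.ne' h2.ne]

/-- Consistency: resampling a smaller set after a larger one does not change the law, when the
weights differ by a factor not depending on the smaller set of coordinates. -/
theorem lintegral_resample_resample {w' g : (V → S) → ℝ≥0} (hw : Measurable w)
    (hc : Continuous w) (hpos : ∀ η, 0 < w η) (hg : Measurable g) (hw' : w' = g * w)
    {L M : Finset V} (hLM : L ⊆ M) (hgL : DependsOn g (L : Set V)ᶜ)
    {F : (V → S) → ℝ≥0∞} (hF : Measurable F) (η : V → S) :
    ∫⁻ ζ, ∫⁻ ζ', F ζ' ∂resample dx w L ζ ∂resample dx w' M η =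
      ∫⁻ ζ, F ζ ∂resample dx w' M η := by
  have hwm := hw.coe_nnreal_ennreal
  have hgm := hg.coe_nnreal_ennreal
  have hw'm : Measurable w' := hw' ▸ hg.mul hw
  have hK := measurable_lintegral_resample dx hw L hF
  rw [lintegral_resample dx hw'm M η hK, lintegral_resample dx hw'm M η hF]
  congr 1
  -- Integrate over `L` first. There `g` and the kernel average of `F` are constant, and this
  -- average times the integral of `w` is the integral of `F * w`.
  have hM : M = (M \ L) ∪ L := (Finset.sdiff_union_of_subset hLM).symm
  rw [hM, lmarginal_union _ _ (hK.mul hw'm.coe_nnreal_ennreal) Finset.sdiff_disjoint,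
    lmarginal_union _ _ (hF.mul hw'm.coe_nnreal_ennreal) Finset.sdiff_disjoint]
  congr 1
  have hgL' : DependsOn (fun η => (g η : ℝ≥0∞)) (L : Set V)ᶜ := fun x y h => by
    simp only [hgL h]
  have hcoe : (fun η => (w' η : ℝ≥0∞)) = (fun η => (g η : ℝ≥0∞)) * fun η => (w η : ℝ≥0∞) := by
    ext; simp [hw']
  rw [hcoe, ← mul_assoc, lmarginal_mul_of_dependsOn dx
    ((dependsOn_lintegral_resample dx hw L hF).mul hgL') hwm, mul_left_comm F,
    lmarginal_mul_of_dependsOn dx hgL' (hF.mul hwm)]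
  ext ζ
  obtain ⟨h1, h2⟩ := lmarginal_weight_pos_lt_top dx hc hpos L ζ
  simp only [Pi.mul_apply, lintegral_resample dx hw L ζ hF]
  rw [mul_right_comm, ENNReal.div_mul_cancel h1.ne' h2.ne, mul_comm]

end Resample

theorem lintegral_resample_smul {V S G : Type*} [DecidableEq V] [MeasurableSpace S] [Group G]
    [MulAction G S] [MeasurableConstSMul G S] (dx : Measure S) [IsProbabilityMeasure dx]
    [SMulInvariantMeasure G S dx] {w : (V → S) → ℝ≥0} (hw : Measurable w)
    (hinv : ∀ (g : G) η, w (g • η) = w η) (L : Finset V) {F : (V → S) → ℝ≥0∞} (hF : Measurable F)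
    (g : G) (η : V → S) :
    ∫⁻ ζ, F ζ ∂resample dx w L (g • η) = ∫⁻ ζ, F (g • ζ) ∂resample dx w L η := by
  have hg : Measurable fun η : V → S => g • η := measurable_const_smul g
  have hFg : Measurable fun ζ => F (g • ζ) := hF.comp hg
  rw [lintegral_resample dx hw L _ hF, lintegral_resample dx hw L _ hFg,
    lmarginal_smul dx L (hF.mul hw.coe_nnreal_ennreal), lmarginal_smul dx L hw.coe_nnreal_ennreal]
  simp only [hinv, Pi.mul_apply]
  rfl

/-! ### Continuity of the kernels in the boundary condition. -/

section Continuity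

variable {V S : Type*} [Countable V] [DecidableEq V] [MeasurableSpace S] [TopologicalSpace S]
  [CompactSpace S] [SecondCountableTopology S] [BorelSpace S] (dx : Measure S)
  [IsProbabilityMeasure dx]

theorem continuous_updateFinset_left {V S : Type*} [DecidableEq V] [TopologicalSpace S]
    (L : Finset V) (ξ : L → S) : Continuous fun η : V → S => Function.updateFinset η L ξ := by
  refine continuous_pi fun i => ?_
  by_cases hi : i ∈ L
  · simp only [Function.updateFinset, hi, dite_true]; exact continuous_const
  · simp only [Function.updateFinset, hi, dite_false]; exact continuous_apply i

/-- Dominated convergence, with the maximum of `F` as dominating constant; countability of `V` makes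
neighbourhood filters countably generated. -/
theorem continuous_lmarginal {F : (V → S) → ℝ≥0} (hF : Continuous F) (L : Finset V) :
    Continuous (lmarginal (fun _ => dx) L fun η => (F η : ℝ≥0∞)) := by
  rw [continuous_iff_continuousAt]
  intro η
  have : Nonempty (V → S) := ⟨η⟩
  obtain ⟨b, -, hb⟩ := isCompact_univ.exists_isMaxOn Set.univ_nonempty hF.continuousOn
  refine tendsto_lintegral_filter_of_dominated_convergence (fun _ => (F b : ℝ≥0∞))
    (Eventually.of_forall fun ζ => (hF.measurable.comp
      measurable_updateFinset).coe_nnreal_ennreal)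
    (Eventually.of_forall fun ζ => ae_of_all _ fun ξ => ENNReal.coe_le_coe.2 (hb (Set.mem_univ _)))
    (by simp) (ae_of_all _ fun ξ => ?_)
  exact ((ENNReal.continuous_coe.comp hF).comp
    (continuous_updateFinset_left L ξ)).continuousAt.tendsto

/-- The Feller property, needed to pass kernel invariance to weak limits. -/
theorem continuous_lintegral_resample {w F : (V → S) → ℝ≥0} (hw : Continuous w)
    (hpos : ∀ η, 0 < w η) (hF : Continuous F) (L : Finset V) :
    Continuous fun η => ∫⁻ ζ, (F ζ : ℝ≥0∞) ∂resample dx w L η := by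
  simp only [lintegral_resample dx hw.measurable L _ hF.measurable.coe_nnreal_ennreal]
  rw [continuous_iff_continuousAt]
  intro η
  obtain ⟨h1, h2⟩ := lmarginal_weight_pos_lt_top dx hw hpos L η
  have h : Continuous (lmarginal (fun _ => dx) L
      ((fun η => (F η : ℝ≥0∞)) * fun η => (w η : ℝ≥0∞))) := by
    convert continuous_lmarginal dx (hF.mul hw) L using 2
    ext; simp
  exact ENNReal.Tendsto.div h.continuousAt (Or.inr h1.ne')
    (continuous_lmarginal dx hw L).continuousAt (Or.inl h2.ne)

end Continuity

/-! ### Boltzmann weights indexed by child vertices. -/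

section Energy

variable {V S : Type*} [MetricSpace S] (T : BoundedRootedTree V) (H : EnergyFunction S)
  (J : Sym2 V → ℝ≥0)

open Classical in
/-- The energy of the edge between a vertex and its parent (zero for the root). -/
def edgeEnergy (y : V) (η : V → S) : ℝ :=
  if y = T.root then 0 else J s(T.parent y, y) * H.toFun (η (T.parent y)) (η y)

/-- The Boltzmann factor of the edge between a vertex and its parent. -/
def edgeWeight (y : V) (η : V → S) : ℝ≥0 := (Real.exp (-edgeEnergy T H J y η)).toNNReal

/-- The product of the Boltzmann factors of the edges from the vertices in `U` to their parents. -/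
def weight (U : Finset V) : (V → S) → ℝ≥0 := ∏ y ∈ U, edgeWeight T H J y

theorem continuous_edgeEnergy (y : V) : Continuous (edgeEnergy T H J y) := by
  unfold edgeEnergy
  split_ifs
  · exact continuous_const
  · have h : Continuous fun η : V → S => (η (T.parent y), η y) :=
      (continuous_apply (T.parent y)).prodMk (continuous_apply y)
    exact continuous_const.mul (H.continuous.comp h)

theorem continuous_edgeWeight (y : V) : Continuous (edgeWeight T H J y) :=
  continuous_real_toNNReal.comp (Real.continuous_exp.comp (continuous_edgeEnergy T H J y).neg)

theorem continuous_weight (U : Finset V) : Continuous (weight T H J U) := by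
  rw [weight, Finset.prod_fn]
  exact continuous_finsetProd _ fun y _ => continuous_edgeWeight T H J y

theorem weight_pos (U : Finset V) (η : V → S) : 0 < weight T H J U η := by
  rw [weight, Finset.prod_apply]
  exact Finset.prod_pos fun y _ => Real.toNNReal_pos.2 (Real.exp_pos _)

theorem edgeWeight_root (η : V → S) : edgeWeight T H J T.root η = 1 := by
  simp [edgeWeight, edgeEnergy]

theorem weight_eq (U : Finset V) (η : V → S) :
    weight T H J U η = (Real.exp (-∑ y ∈ U, edgeEnergy T H J y η)).toNNReal := by
  rw [weight, Finset.prod_apply, ← Finset.sum_neg_distrib, Real.exp_sum,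
    Real.toNNReal_prod_of_nonneg fun y _ => (Real.exp_pos _).le]
  rfl

theorem dependsOn_edgeWeight {y : V} {s : Set V}
    (h : y = T.root ∨ y ∈ s ∧ T.parent y ∈ s) : DependsOn (edgeWeight (S := S) T H J y) s := by
  intro η η' hη
  unfold edgeWeight edgeEnergy
  split_ifs with hy
  · rfl
  · obtain ⟨h1, h2⟩ := h.resolve_left hy
    rw [hη _ h1, hη _ h2]

theorem dependsOn_weight {U : Finset V} {s : Set V}
    (h : ∀ y ∈ U, y = T.root ∨ y ∈ s ∧ T.parent y ∈ s) :
    DependsOn (weight (S := S) T H J U) s :=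
  DependsOn.finset_prod fun y hy => dependsOn_edgeWeight T H J (h y hy)

theorem edgeWeight_smul {G : Type*} [Group G] [MulAction G S] [IsIsometricSMul G S] (y : V) (g : G)
    (η : V → S) : edgeWeight T H J y (g • η) = edgeWeight T H J y η := by
  unfold edgeWeight edgeEnergy
  simp only [Pi.smul_apply]
  rw [H.dist_invariant (g • η (T.parent y)) (g • η y) (η (T.parent y)) (η y) (dist_smul _ _ _)]

theorem weight_smul {G : Type*} [Group G] [MulAction G S] [IsIsometricSMul G S] (U : Finset V)
    (g : G) (η : V → S) : weight T H J U (g • η) = weight T H J U η := by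
  simp only [weight, Finset.prod_apply, edgeWeight_smul]

-- At most one summand on the right is present, since two vertices cannot be parents of each other;
-- the root, its own parent, contributes zero by the convention in `edgeEnergy`.
open Classical in
theorem ite_adj_eq [DecidableEq V] (η : V → S) (x y : V) :
    (if T.graph.Adj x y then (J s(x, y) : ℝ) * H.toFun (η x) (η y) else 0) =
      (if x = T.parent y then edgeEnergy T H J y η else 0) +
        if y = T.parent x then edgeEnergy T H J x η else 0 := by
  have hnot : ¬ ((y ≠ T.root ∧ x = T.parent y) ∧ x ≠ T.root ∧ y = T.parent x) := by
    rintro ⟨⟨h1, h2⟩, h3, h4⟩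
    have h5 := (T.parent_spec h1).2
    have h6 := (T.parent_spec h3).2
    rw [← h2] at h5
    rw [← h4] at h6
    omega
  have key : ∀ a b, (if a = T.parent b then edgeEnergy T H J b η else 0) =
      if b ≠ T.root ∧ a = T.parent b then (J s(a, b) : ℝ) * H.toFun (η a) (η b) else 0 := by
    intro a b
    unfold edgeEnergy
    by_cases hb : b = T.root
    · simp [hb]
    · by_cases ha : a = T.parent b
      · subst ha; simp [hb]
      · simp [ha]
  rw [key, key, H.symm (η y), Sym2.eq_swap (a := y)]
  simp only [T.adj_iff]
  by_cases h1 : y ≠ T.root ∧ x = T.parent y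
  · have h2 : ¬ (x ≠ T.root ∧ y = T.parent x) := fun h => hnot ⟨h1, h⟩
    rw [if_pos (Or.inl h1), if_pos h1, if_neg h2, add_zero]
  · rw [if_neg h1, zero_add]
    by_cases h2 : x ≠ T.root ∧ y = T.parent x
    · rw [if_pos (Or.inr h2), if_pos h2]
    · rw [if_neg (by tauto), if_neg h2]

/-- The energy in a region `L` with boundary `D` is the sum over the edges from the vertices to
their parents, when `L ∪ D` consists of a top vertex `t` and of children of vertices in `L`. -/
theorem hamiltonian_eq_sum [DecidableEq V] {L D : Finset V} (hLD : Disjoint L D) {t : V}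
    (ht : t ∈ L) (hpar : ∀ y ∈ L ∪ D, y ≠ t → T.parent y ∈ L)
    (htop : t = T.root ∨ T.parent t ∉ L ∪ D) (η : V → S) :
    hamiltonian T.graph H J L D (fun y => η y) (fun x => η x) =
      ∑ y ∈ (L ∪ D).erase t, edgeEnergy T H J y η := by
  classical
  unfold hamiltonian
  simp only [ite_adj_eq T H J η]
  have hL : ∀ (A B : Finset V) (f : V → V → ℝ), ∑ x : A, ∑ y : B, f x y =
      ∑ x ∈ A, ∑ y ∈ B, f x y := by
    intro A B f
    rw [← Finset.sum_coe_sort A]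
    exact Finset.sum_congr rfl fun x _ => Finset.sum_coe_sort B _
  -- The edge above the top vertex is the only one that could be counted wrongly: it has zero energy
  -- at the root and otherwise leaves the region.
  have etop : ∀ A, A ⊆ L ∪ D → (if T.parent t ∈ A then edgeEnergy T H J t η else 0) = 0 := by
    intro A hA
    rcases htop with h | h
    · simp [edgeEnergy, h]
    · rw [if_neg fun h' => h (hA h')]
  have hsub : L ⊆ L ∪ D := Finset.subset_union_left
  have e1 : ∑ y ∈ L, (if T.parent y ∈ L then edgeEnergy T H J y η else 0) =
      ∑ y ∈ L.erase t, edgeEnergy T H J y η := by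
    rw [← Finset.add_sum_erase L _ ht, etop L hsub, zero_add]
    refine Finset.sum_congr rfl fun y hy => ?_
    rw [if_pos (hpar y (hsub (Finset.mem_of_mem_erase hy)) (Finset.ne_of_mem_erase hy))]
  have e2 : ∑ y ∈ D, (if T.parent y ∈ L then edgeEnergy T H J y η else 0) =
      ∑ y ∈ D, edgeEnergy T H J y η := by
    refine Finset.sum_congr rfl fun y hy => ?_
    rw [if_pos (hpar y (Finset.mem_union_right _ hy) _)]
    rintro rfl
    exact Finset.disjoint_left.1 hLD ht hy
  have e3 : ∑ x ∈ L, (if T.parent x ∈ D then edgeEnergy T H J x η else 0) = 0 := by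
    rw [← Finset.add_sum_erase L _ ht, etop D Finset.subset_union_right, zero_add]
    refine Finset.sum_eq_zero fun y hy => ?_
    rw [if_neg]
    exact Finset.disjoint_left.1 hLD
      (hpar y (hsub (Finset.mem_of_mem_erase hy)) (Finset.ne_of_mem_erase hy))
  rw [hL L L (fun x y => (if x = T.parent y then edgeEnergy T H J y η else 0) +
      if y = T.parent x then edgeEnergy T H J x η else 0),
    hL L D (fun x y => (if x = T.parent y then edgeEnergy T H J y η else 0) +
      if y = T.parent x then edgeEnergy T H J x η else 0)]
  simp only [Finset.sum_add_distrib]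
  -- After exchanging sums, both orientations of an inner edge are indexed by the child, and the two
  -- equal copies absorb the factor one half.
  rw [Finset.sum_comm (s := L) (t := L) (f := fun x y =>
      if x = T.parent y then edgeEnergy T H J y η else 0),
    Finset.sum_comm (s := L) (t := D) (f := fun x y =>
      if x = T.parent y then edgeEnergy T H J y η else 0)]
  simp only [Finset.sum_ite_eq']
  rw [e1, e2, e3, Finset.erase_union_distrib,
    Finset.erase_eq_of_notMem (Finset.disjoint_left.1 hLD ht), Finset.sum_union
      (hLD.mono_left (Finset.erase_subset _ _))]
  ring

end Energy

/-! ### Gibbs measures as resampling kernels. -/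

section GibbsResample

variable {V S : Type*} [Countable V] [DecidableEq V] [MetricSpace S] [CompactSpace S]
  [MeasurableSpace S] [BorelSpace S] (T : BoundedRootedTree V) (H : EnergyFunction S)
  (J : Sym2 V → ℝ≥0) (dx : Measure S) [IsProbabilityMeasure dx]

/-- The Gibbs measure as the law of the resampled coordinates. -/
theorem gibbsMeasure_eq_map_resample {L D : Finset V} (hLD : Disjoint L D) {t : V}
    (ht : t ∈ L) (hpar : ∀ y ∈ L ∪ D, y ≠ t → T.parent y ∈ L)
    (htop : t = T.root ∨ T.parent t ∉ L ∪ D) (η : V → S) :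
    gibbsMeasure T.graph H J dx L D (fun y => η y) =
      (resample dx (weight T H J ((L ∪ D).erase t)) L η).map fun ζ (x : L) => ζ x := by
  have hrestr : Measurable fun (ζ : V → S) (x : L) => ζ x :=
    measurable_pi_lambda _ fun x => measurable_pi_apply _
  have hw := continuous_weight T H J ((L ∪ D).erase t)
  obtain ⟨h1, h2⟩ := lmarginal_weight_pos_lt_top dx hw (weight_pos T H J _) L η
  have hid : (fun (ζ : V → S) (x : L) => ζ x) ∘ Function.updateFinset η L = id := by
    ext ξ x
    simp [Function.updateFinset]
  rw [resample, Measure.map_map hrestr measurable_updateFinset, hid, Measure.map_id, gibbsMeasure]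
  congr 1
  have hham : ∀ ξ : L → S, ENNReal.ofReal (Real.exp (-hamiltonian T.graph H J L D
      (fun y => η y) ξ)) = weight T H J ((L ∪ D).erase t) (Function.updateFinset η L ξ) := by
    intro ξ
    rw [weight_eq, ← hamiltonian_eq_sum T H J hLD ht hpar htop]
    congr 5
    · ext y
      have : (y : V) ∉ L := fun h => Finset.disjoint_left.1 hLD h y.2
      simp [Function.updateFinset, this]
    · ext x
      simp [Function.updateFinset]
  have hZ : ∫ ξ, Real.exp (-hamiltonian T.graph H J L D (fun y => η y) ξ)
      ∂(Measure.pi fun _ : L => dx) =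
      (lmarginal (fun _ => dx) L
        (fun η => (weight T H J ((L ∪ D).erase t) η : ℝ≥0∞)) η).toReal := by
    rw [integral_eq_lintegral_of_nonneg_ae (ae_of_all _ fun ξ => (Real.exp_pos _).le)]
    · simp only [hham]; rfl
    · refine Measurable.aestronglyMeasurable ?_
      have : (fun ξ : L → S => Real.exp (-hamiltonian T.graph H J L D (fun y => η y) ξ)) =
          fun ξ => ((weight T H J ((L ∪ D).erase t) (Function.updateFinset η L ξ) : ℝ≥0) : ℝ) := by
        ext ξ
        rw [← ENNReal.coe_toReal, ← hham, ENNReal.toReal_ofReal (Real.exp_pos _).le]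
      rw [this]
      exact (hw.measurable.comp measurable_updateFinset).coe_nnreal_real
  ext ξ
  rw [hZ, ENNReal.ofReal_div_of_pos (ENNReal.toReal_pos h1.ne' h2.ne), hham,
    ENNReal.ofReal_toReal h2.ne]

theorem gibbsMeasure_inside_apply (C : T.Cutset) (η : V → S) {A : Set (C.inside → S)}
    (hA : MeasurableSet A) :
    gibbsMeasure T.graph H J dx C.inside C.carrier (fun y => η y) A =
      resample dx (weight T H J (C.inside ∪ C.carrier)) C.inside η
        ((fun ζ (x : C.inside) => ζ x) ⁻¹' A) := by
  have hrestr : Measurable fun (ζ : V → S) (x : C.inside) => ζ x :=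
    measurable_pi_lambda _ fun x => measurable_pi_apply _
  rw [gibbsMeasure_eq_map_resample T H J dx (Finset.disjoint_left.2 fun x => C.notMem_carrier)
    C.root_mem_inside ?_ (Or.inl rfl), Measure.map_apply hrestr hA]
  · have hwt : weight (S := S) T H J ((C.inside ∪ C.carrier).erase T.root) =
        weight T H J (C.inside ∪ C.carrier) := by
      funext ζ
      have h := Finset.mul_prod_erase (C.inside ∪ C.carrier) (fun y => edgeWeight T H J y ζ)
        (Finset.mem_union_left _ C.root_mem_inside)
      rw [edgeWeight_root, one_mul] at h
      simp only [weight, Finset.prod_apply, h]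
    rw [hwt]
  · intro y hy _
    rcases Finset.mem_union.1 hy with hy | hy
    · exact C.mem_inside_of_below hy (BoundedRootedTree.parent_below y)
    · exact C.parent_mem_inside hy

theorem gibbsMeasure_insideAbove (C : T.Cutset) (η : V → S) {v : V} (hv : v ∈ C.inside) :
    gibbsMeasure T.graph H J dx (C.insideAbove v) (C.carrierAbove v) (fun y => η y) =
      (resample dx (weight T H J ((C.insideAbove v ∪ C.carrierAbove v).erase v))
        (C.insideAbove v) η).map fun ζ (x : C.insideAbove v) => ζ x := by
  refine gibbsMeasure_eq_map_resample T H J dx ?_ (C.mem_insideAbove hv) ?_ ?_ η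
  · refine Finset.disjoint_left.2 fun x hx hx' => ?_
    rw [C.mem_insideAbove_iff] at hx
    exact C.notMem_carrier hx.1 (C.mem_of_mem_carrierAbove hx')
  · intro y hy hne
    rw [Finset.mem_union, C.mem_insideAbove_iff, C.mem_carrierAbove_iff] at hy
    rw [C.mem_insideAbove_iff]
    rcases hy with ⟨h1, h2⟩ | ⟨h1, h2⟩
    · exact ⟨C.mem_inside_of_below h1 (BoundedRootedTree.parent_below y),
        h2.below_parent hne.symm⟩
    · exact ⟨C.parent_mem_inside h1, h2.below_parent hne.symm⟩
  · by_cases hr : v = T.root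
    · exact Or.inl hr
    · refine Or.inr fun h => ?_
      have h1 : T.Below v (T.parent v) := by
        rw [Finset.mem_union, C.mem_insideAbove_iff, C.mem_carrierAbove_iff] at h
        tauto
      have := h1.dist_le
      have := (T.parent_spec hr).2
      omega

/-- The law of the spin at `v` under the Gibbs measure on the part of `Cⁱ` above `v`. -/
theorem map_gibbsMeasure_insideAbove (C : T.Cutset) (η : V → S) {v : V} (hv : v ∈ C.inside) :
    (gibbsMeasure T.graph H J dx (C.insideAbove v) (C.carrierAbove v) (fun y => η y)).map
        (fun ξ => ξ ⟨v, C.mem_insideAbove hv⟩) =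
      (resample dx (weight T H J ((C.insideAbove v ∪ C.carrierAbove v).erase v))
        (C.insideAbove v) η).map fun ζ => ζ v := by
  have hrestr : Measurable fun (ζ : V → S) (x : C.insideAbove v) => ζ x :=
    measurable_pi_lambda _ fun x => measurable_pi_apply _
  rw [gibbsMeasure_insideAbove T H J dx C η hv, Measure.map_map (measurable_pi_apply _) hrestr]
  rfl

end GibbsResample

theorem resample_smul_apply {V S G : Type*} [DecidableEq V] [MeasurableSpace S] [Group G]
    [MulAction G S] [MeasurableConstSMul G S] (dx : Measure S) [IsProbabilityMeasure dx]
    [SMulInvariantMeasure G S dx] {w : (V → S) → ℝ≥0} (hw : Measurable w)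
    (hinv : ∀ (g : G) η, w (g • η) = w η) (L : Finset V) {s : Set (V → S)} (hs : MeasurableSet s)
    (g : G) (η : V → S) :
    resample dx w L (g • η) s = resample dx w L η ((fun ζ => g • ζ) ⁻¹' s) := by
  have hg : Measurable fun η : V → S => g • η := measurable_const_smul g
  rw [← lintegral_indicator_one hs, ← lintegral_indicator_one (hg hs),
    lintegral_resample_smul dx hw hinv L (measurable_one.indicator hs)]
  rfl

theorem resample_inter_apply {V S : Type*} [DecidableEq V] [MeasurableSpace S] (dx : Measure S)
    (w : (V → S) → ℝ≥0) (L : Finset V) {a b : Set (V → S)} (ha : MeasurableSet a)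
    (hb : MeasurableSet b) (hbL : DependsOn (· ∈ b) (L : Set V)ᶜ) (η : V → S) :
    resample dx w L η (a ∩ b) = b.indicator (fun η => resample dx w L η a) η := by
  have h : ∀ ξ, (Function.updateFinset η L ξ ∈ b) = (η ∈ b) := fun ξ =>
    hbL fun i hi => by simp only [Function.updateFinset]; rw [dif_neg (by exact hi)]
  by_cases hη : η ∈ b
  · rw [Set.indicator_of_mem hη, resample, Measure.map_apply measurable_updateFinset (ha.inter hb),
      Measure.map_apply measurable_updateFinset ha]
    congr 1
    ext ξ
    simp [h, hη]
  · rw [Set.indicator_of_notMem hη, resample,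
      Measure.map_apply measurable_updateFinset (ha.inter hb)]
    have : Function.updateFinset η L ⁻¹' (a ∩ b) = ∅ := by
      ext ξ
      simp [h, hη]
    rw [this, measure_empty]

/-! ### Gibbs states and the group action; symmetry breaking implies phase transition. -/

section Gibbs

variable {V S : Type*} [Countable V] [MetricSpace S] [CompactSpace S]
  [MeasurableSpace S] [BorelSpace S] {T : BoundedRootedTree V} {H : EnergyFunction S}
  {J : Sym2 V → ℝ≥0}

theorem measurable_weight (U : Finset V) : Measurable (weight (S := S) T H J U) :=
  (continuous_weight T H J U).measurable

variable [DecidableEq V] {dx : Measure S} [IsProbabilityMeasure dx]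

theorem measurable_gibbsMeasure_inside_apply (C : T.Cutset) {A : Set (C.inside → S)}
    (hA : MeasurableSet A) : Measurable fun η : V → S =>
      gibbsMeasure T.graph H J dx C.inside C.carrier (fun y => η y) A := by
  have hrestr : Measurable fun (ζ : V → S) (x : C.inside) => ζ x :=
    measurable_pi_lambda _ fun x => measurable_pi_apply _
  simp only [gibbsMeasure_inside_apply T H J dx C _ hA]
  exact (Measure.measurable_coe (hrestr hA)).comp
    (measurable_resample dx (measurable_weight _) C.inside)

/-- The kernel fixes the spins outside `C.inside`, so an exterior event factors out of it
(`resample_inter_apply`), and invariance alone yields the conditional law. -/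
theorem isGibbsState_of_bind_eq {μ : Measure (V → S)} [IsProbabilityMeasure μ]
    (h : ∀ C : T.Cutset,
      μ.bind (resample dx (weight T H J (C.inside ∪ C.carrier)) C.inside) = μ) :
    IsGibbsState T H J dx μ := by
  refine ⟨inferInstance, fun C A B hA hB => ?_⟩
  have hrestr : Measurable fun (ζ : V → S) (x : C.inside) => ζ x :=
    measurable_pi_lambda _ fun x => measurable_pi_apply _
  have hrestr' : Measurable fun (ζ : V → S) (x : {x : V // x ∉ C.inside}) => ζ x :=
    measurable_pi_lambda _ fun x => measurable_pi_apply _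
  have ha := hrestr hA
  have hb := hrestr' hB
  have key : μ (((fun (ζ : V → S) (x : C.inside) => ζ x) ⁻¹' A) ∩
      ((fun (ζ : V → S) (x : {x : V // x ∉ C.inside}) => ζ x) ⁻¹' B)) =
      ∫⁻ η in (fun (ζ : V → S) (x : {x : V // x ∉ C.inside}) => ζ x) ⁻¹' B,
        resample dx (weight T H J (C.inside ∪ C.carrier)) C.inside η
          ((fun (ζ : V → S) (x : C.inside) => ζ x) ⁻¹' A) ∂μ := by
    conv_lhs => rw [← h C]
    rw [Measure.bind_apply (ha.inter hb)
      (measurable_resample dx (measurable_weight _) C.inside).aemeasurable,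
      ← lintegral_indicator hb]
    refine lintegral_congr fun η => resample_inter_apply dx _ _ ha hb (fun x y hxy => ?_) η
    have : (fun (i : {x : V // x ∉ C.inside}) => x i.1) = fun i => y i.1 :=
      funext fun i => hxy i.1 i.2
    simp only [Set.mem_preimage, this]
  simp only [gibbsMeasure_inside_apply T H J dx C _ hA]
  exact key

theorem IsGibbsState.map_restrict_apply {μ : Measure (V → S)} (h : IsGibbsState T H J dx μ)
    (C : T.Cutset) {A : Set (C.inside → S)} (hA : MeasurableSet A) :
    μ ((fun ζ (x : C.inside) => ζ x) ⁻¹' A) =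
      ∫⁻ η, resample dx (weight T H J (C.inside ∪ C.carrier)) C.inside η
        ((fun ζ (x : C.inside) => ζ x) ⁻¹' A) ∂μ := by
  have := h.2 C A Set.univ hA MeasurableSet.univ
  simp only [Set.mem_univ, and_true, Set.ofPred_true, Measure.restrict_univ,
    gibbsMeasure_inside_apply T H J dx C _ hA] at this
  exact this

variable {G : Type*} [Group G] [MulAction G S] [IsIsometricSMul G S] [SMulInvariantMeasure G S dx]

/-- Isometries preserve the energy and `dx` is invariant, so the kernels commute with the diagonal
action. -/
theorem IsGibbsState.map_smul {μ : Measure (V → S)} (h : IsGibbsState T H J dx μ) (g : G) :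
    IsGibbsState T H J dx (μ.map fun η => g • η) := by
  have hp := h.1
  have hg : Measurable fun η : V → S => g • η := measurable_const_smul g
  refine ⟨Measure.isProbabilityMeasure_map hg.aemeasurable, fun C A B hA hB => ?_⟩
  have hrestr : Measurable fun (ζ : V → S) (x : C.inside) => ζ x :=
    measurable_pi_lambda _ fun x => measurable_pi_apply _
  have hrestr' : Measurable fun (ζ : V → S) (x : {x : V // x ∉ C.inside}) => ζ x :=
    measurable_pi_lambda _ fun x => measurable_pi_apply _
  have hgL : Measurable fun ξ : C.inside → S => g • ξ := measurable_const_smul g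
  have hgL' : Measurable fun ξ : {x : V // x ∉ C.inside} → S => g • ξ := measurable_const_smul g
  have hE : MeasurableSet {η : V → S | (fun x : C.inside => η x) ∈ A ∧
      (fun x : {x : V // x ∉ C.inside} => η x) ∈ B} := (hrestr hA).inter (hrestr' hB)
  have hE' : MeasurableSet {η : V → S | (fun x : {x : V // x ∉ C.inside} => η x) ∈ B} :=
    hrestr' hB
  rw [Measure.map_apply hg hE, setLIntegral_map hE' (measurable_gibbsMeasure_inside_apply C hA) hg]
  have key : ∀ η : V → S,
      gibbsMeasure T.graph H J dx C.inside C.carrier (fun y => (g • η) y) A =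
        gibbsMeasure T.graph H J dx C.inside C.carrier (fun y => η y)
          ((fun ξ => g • ξ) ⁻¹' A) := by
    intro η
    rw [gibbsMeasure_inside_apply T H J dx C _ hA,
      gibbsMeasure_inside_apply T H J dx C _ (hgL hA),
      resample_smul_apply dx (measurable_weight _) (weight_smul T H J _) _ (hrestr hA)]
    rfl
  simp only [key]
  exact h.2 C _ _ (hgL hA) (hgL' hB)

theorem PhaseTransition.of_symmetryBreaking (h : SymmetryBreaking T H J dx G) :
    PhaseTransition T H J dx := by
  obtain ⟨μ, hμ, v, hv⟩ := h
  by_contra hno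
  refine hv ⟨fun g s hs => ?_⟩
  have hg : Measurable fun η : V → S => g • η := measurable_const_smul g
  have hgS : Measurable fun x : S => g • x := measurable_const_smul g
  have heq : (μ.map fun η => g • η) = μ := by
    by_contra hne
    exact hno ⟨_, _, hμ.map_smul g, hμ, hne⟩
  have hs' : MeasurableSet ((fun η : V → S => η v) ⁻¹' s) := measurable_pi_apply v hs
  rw [Measure.map_apply (measurable_pi_apply v) (hgS hs),
    Measure.map_apply (measurable_pi_apply v) hs]
  conv_rhs => rw [← heq]
  rw [Measure.map_apply hg hs']
  rfl

end Gibbs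

/-! ### Uniqueness: splitting a cutset's inside into a ball and branches. -/

section BallTree

variable {V : Type*} {T : BoundedRootedTree V} {n : ℕ}

theorem notMem_ball_of_below {x w : V} (hx : w ∈ T.sphere (n + 1))
    (h : T.Below w x) : x ∉ T.ball n := by
  have := h.dist_le
  rw [BoundedRootedTree.mem_sphere] at hx
  rw [BoundedRootedTree.mem_ball]
  omega

theorem eq_of_below_of_mem_sphere {x w w' : V} (hw : w ∈ T.sphere (n + 1))
    (hw' : w' ∈ T.sphere (n + 1)) (h : T.Below w x) (h' : T.Below w' x) : w = w' := by
  rw [BoundedRootedTree.mem_sphere] at hw hw'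
  exact h.eq_of_dist_eq h' (by omega)

theorem exists_mem_sphere_below {x : V} (hx : x ∉ T.ball n) :
    ∃ w ∈ T.sphere (n + 1), T.Below w x := by
  rw [BoundedRootedTree.mem_ball] at hx
  obtain ⟨w, hw, hd⟩ := BoundedRootedTree.exists_below_dist_eq (T := T) (x := x) (n := n + 1)
    (by omega)
  exact ⟨w, BoundedRootedTree.mem_sphere.2 hd, hw⟩

variable [DecidableEq V]

theorem inside_eq_ball_union {C : T.Cutset} (hball : T.ball n ⊆ C.inside) :
    C.inside = T.ball n ∪ (T.sphere (n + 1)).biUnion C.insideAbove := by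
  ext x
  simp only [Finset.mem_union, Finset.mem_biUnion, C.mem_insideAbove_iff]
  constructor
  · intro hx
    by_cases h : x ∈ T.ball n
    · exact Or.inl h
    · obtain ⟨w, hw, hwx⟩ := exists_mem_sphere_below h
      exact Or.inr ⟨w, hw, hx, hwx⟩
  · rintro (h | ⟨w, -, h, -⟩)
    · exact hball h
    · exact h

theorem inside_union_carrier_eq {C : T.Cutset} (hball : T.ball n ⊆ C.inside) :
    C.inside ∪ C.carrier = T.ball n ∪
      (T.sphere (n + 1)).biUnion fun w => C.insideAbove w ∪ C.carrierAbove w := by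
  ext x
  simp only [Finset.mem_union, Finset.mem_biUnion, C.mem_insideAbove_iff, C.mem_carrierAbove_iff]
  constructor
  · intro hx
    by_cases h : x ∈ T.ball n
    · exact Or.inl h
    · obtain ⟨w, hw, hwx⟩ := exists_mem_sphere_below h
      exact Or.inr ⟨w, hw, by tauto⟩
  · rintro (h | ⟨w, -, h | h⟩)
    · exact Or.inl (hball h)
    · exact Or.inl h.1
    · exact Or.inr h.1

theorem disjoint_ball_insideAbove (C : T.Cutset) :
    Disjoint (T.ball n) ((T.sphere (n + 1)).biUnion C.insideAbove) := by
  refine Finset.disjoint_left.2 fun x hx hx' => ?_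
  obtain ⟨w, hw, h⟩ := Finset.mem_biUnion.1 hx'
  exact notMem_ball_of_below hw ((C.mem_insideAbove_iff).1 h).2 hx

end BallTree

section EWeight

variable {V S : Type*} [MetricSpace S] (T : BoundedRootedTree V) (H : EnergyFunction S)
  (J : Sym2 V → ℝ≥0)

/-- The Boltzmann weight as an extended nonnegative function. -/
def eweight (U : Finset V) : (V → S) → ℝ≥0∞ := fun η => (weight T H J U η : ℝ≥0∞)

variable {T H J}

theorem dependsOn_eweight {U : Finset V} {s : Set V}
    (h : ∀ y ∈ U, y = T.root ∨ y ∈ s ∧ T.parent y ∈ s) :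
    DependsOn (eweight (S := S) T H J U) s := fun x y hxy => by
  simp only [eweight, dependsOn_weight T H J h hxy]

theorem measurable_eweight [Countable V] [CompactSpace S] [MeasurableSpace S] [BorelSpace S]
    (U : Finset V) : Measurable (eweight (S := S) T H J U) :=
  (measurable_weight U).coe_nnreal_ennreal

variable [DecidableEq V]

theorem eweight_union {U U' : Finset V} (h : Disjoint U U') :
    eweight (S := S) T H J (U ∪ U') = eweight T H J U * eweight T H J U' := by
  ext η
  simp [eweight, weight, Finset.prod_union h]

theorem eweight_biUnion {A : Finset V} {U : V → Finset V}
    (h : ∀ i ∈ A, ∀ j ∈ A, i ≠ j → Disjoint (U i) (U j)) :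
    eweight (S := S) T H J (A.biUnion U) = ∏ w ∈ A, eweight T H J (U w) := by
  ext η
  rw [eweight, weight, Finset.prod_biUnion fun i hi j hj hij => h i hi j hj hij]
  simp [eweight, weight, Finset.prod_apply]

theorem eweight_singleton_mul_erase {U : Finset V} {w : V} (hw : w ∈ U) :
    eweight (S := S) T H J {w} * eweight T H J (U.erase w) = eweight T H J U := by
  rw [← eweight_union (by simp), ← Finset.insert_eq, Finset.insert_erase hw]

theorem lmarginal_eweight_pos_lt_top [CompactSpace S] [MeasurableSpace S] {dx : Measure S}
    [IsProbabilityMeasure dx] (U L : Finset V) (η : V → S) :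
    0 < lmarginal (fun _ => dx) L (eweight T H J U) η ∧
      lmarginal (fun _ => dx) L (eweight T H J U) η < ⊤ :=
  lmarginal_weight_pos_lt_top dx (continuous_weight T H J U) (weight_pos T H J U) L η

/-- The weight of the interior of a cutset beyond a ball factorizes. -/
theorem eweight_inside_union_carrier {n : ℕ} {C : T.Cutset} (hball : T.ball n ⊆ C.inside)
    (hsph : T.sphere (n + 1) ⊆ C.inside) :
    eweight (S := S) T H J (C.inside ∪ C.carrier) = eweight T H J (T.ball n) *
      ∏ w ∈ T.sphere (n + 1), eweight T H J {w} *
        eweight T H J ((C.insideAbove w ∪ C.carrierAbove w).erase w) := by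
  have hbelow : ∀ w x, x ∈ C.insideAbove w ∪ C.carrierAbove w → T.Below w x := by
    intro w x hx
    rw [Finset.mem_union, C.mem_insideAbove_iff, C.mem_carrierAbove_iff] at hx
    tauto
  rw [inside_union_carrier_eq hball, eweight_union, eweight_biUnion]
  · congr 1
    refine Finset.prod_congr rfl fun w hw => ?_
    rw [eweight_singleton_mul_erase (Finset.mem_union_left _ (C.mem_insideAbove (hsph hw)))]
  · intro w hw w' hw' hne
    refine Finset.disjoint_left.2 fun x hx hx' => hne ?_
    exact eq_of_below_of_mem_sphere hw hw' (hbelow w x hx) (hbelow w' x hx')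
  · refine Finset.disjoint_left.2 fun x hx hx' => ?_
    obtain ⟨w, hw, h⟩ := Finset.mem_biUnion.1 hx'
    exact notMem_ball_of_below hw (hbelow w x h) hx

end EWeight

/-! ### Uniqueness: integrating out the branches beyond a ball. -/

section Comparison

variable {V S : Type*} [DecidableEq V] [MetricSpace S] [MeasurableSpace S]
  (T : BoundedRootedTree V) (H : EnergyFunction S) (J : Sym2 V → ℝ≥0) (dx : Measure S)

/-- The integral of the Boltzmann factor of the edge from `w` to its parent over the spin at `w`. -/
def edgeIntegral (w : V) : (V → S) → ℝ≥0∞ :=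
  lmarginal (fun _ => dx) {w} (eweight T H J {w})

/-- The edge from `w` to its parent, integrated against the Gibbs measure above `w`, is
within the factor `r` of its integral against `dx`, for all boundary conditions. -/
def NearlyFree (r : ℝ≥0∞) (C : T.Cutset) (w : V) : Prop :=
  ∀ η : V → S,
    lmarginal (fun _ => dx) (C.insideAbove w)
        (eweight T H J {w} * eweight T H J ((C.insideAbove w ∪ C.carrierAbove w).erase w)) η ≤
      r * (edgeIntegral T H J dx w η * lmarginal (fun _ => dx) (C.insideAbove w)
        (eweight T H J ((C.insideAbove w ∪ C.carrierAbove w).erase w)) η) ∧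
    edgeIntegral T H J dx w η * lmarginal (fun _ => dx) (C.insideAbove w)
        (eweight T H J ((C.insideAbove w ∪ C.carrierAbove w).erase w)) η ≤
      r * lmarginal (fun _ => dx) (C.insideAbove w)
        (eweight T H J {w} * eweight T H J ((C.insideAbove w ∪ C.carrierAbove w).erase w)) η

/-- The weight on the ball of radius `n` with the edges to the next sphere integrated out. -/
def ballWeight (n : ℕ) : (V → S) → ℝ≥0∞ :=
  eweight T H J (T.ball n) * ∏ w ∈ T.sphere (n + 1), edgeIntegral T H J dx w

variable {T H J dx}

theorem dependsOn_edgeIntegral {w : V} (hw : w ≠ T.root) :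
    DependsOn (edgeIntegral T H J dx w) {T.parent w} := by
  refine (dependsOn_lmarginal dx (s := {w, T.parent w}) (dependsOn_eweight ?_)).mono ?_
  · intro y hy
    rw [Finset.mem_singleton] at hy
    subst hy
    simp
  · intro x
    simp only [Set.mem_sdiff, Set.mem_insert_iff, Set.mem_singleton_iff, Finset.coe_singleton]
    tauto

variable {n : ℕ}

theorem dependsOn_ballWeight : DependsOn (ballWeight T H J dx n) (T.ball n : Set V) := by
  refine DependsOn.mul (dependsOn_eweight fun y hy => ?_) (DependsOn.finset_prod fun w hw => ?_)
  · refine Or.inr ⟨hy, ?_⟩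
    have := (BoundedRootedTree.parent_below (T := T) y).dist_le
    rw [BoundedRootedTree.mem_ball] at hy
    simp only [Finset.mem_coe, BoundedRootedTree.mem_ball]
    omega
  · rw [BoundedRootedTree.mem_sphere] at hw
    have hwr : w ≠ T.root := by rintro rfl; simp at hw
    refine (dependsOn_edgeIntegral hwr).mono ?_
    have := (T.parent_spec hwr).2
    simp only [Set.singleton_subset_iff, Finset.mem_coe, BoundedRootedTree.mem_ball]
    omega

/-- The normalization of the part of the Gibbs measure beyond the ball of radius `n`. -/
def outerPartition (dx : Measure S) (H : EnergyFunction S) (J : Sym2 V → ℝ≥0) (n : ℕ)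
    (C : T.Cutset) : (V → S) → ℝ≥0∞ :=
  ∏ w ∈ T.sphere (n + 1), lmarginal (fun _ => dx) (C.insideAbove w)
    (eweight T H J ((C.insideAbove w ∪ C.carrierAbove w).erase w))

/-- The edge joining `w` to the ball has been erased, so a branch normalization does not see the
ball; it will cancel between numerator and denominator. -/
theorem dependsOn_outerPartition (C : T.Cutset) :
    DependsOn (outerPartition dx H J n C) (T.ball n : Set V)ᶜ := by
  refine DependsOn.finset_prod fun w hw => (dependsOn_lmarginal dx (dependsOn_eweight
    (s := (T.ball n : Set V)ᶜ) fun y hy => Or.inr ?_)).mono Set.sdiff_subset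
  have hy' : T.Below w y := by
    have := Finset.mem_of_mem_erase hy
    rw [Finset.mem_union, C.mem_insideAbove_iff, C.mem_carrierAbove_iff] at this
    tauto
  exact ⟨notMem_ball_of_below hw hy',
    notMem_ball_of_below hw (hy'.below_parent (Finset.ne_of_mem_erase hy).symm)⟩

variable [Countable V] [CompactSpace S] [BorelSpace S] [IsProbabilityMeasure dx]

theorem measurable_edgeIntegral (w : V) : Measurable (edgeIntegral T H J dx w) :=
  (measurable_eweight {w}).lmarginal _

theorem measurable_ballWeight : Measurable (ballWeight T H J dx n) := by
  refine (measurable_eweight _).mul ?_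
  rw [Finset.prod_fn]
  exact Finset.measurable_prod _ fun w _ => measurable_edgeIntegral w

/-- Given the spins in the ball, distinct branches share no variable of integration and no edge, so
the integral over them is a product over the sphere. -/
theorem lmarginal_inside_eq {C : T.Cutset} (hball : T.ball n ⊆ C.inside)
    (hsph : T.sphere (n + 1) ⊆ C.inside) {F : (V → S) → ℝ≥0∞} (hF : Measurable F)
    (hFd : DependsOn F (T.ball n : Set V)) :
    lmarginal (fun _ => dx) C.inside (F * eweight T H J (C.inside ∪ C.carrier)) =
      lmarginal (fun _ => dx) (T.ball n) (F * (eweight T H J (T.ball n) *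
        ∏ w ∈ T.sphere (n + 1), lmarginal (fun _ => dx) (C.insideAbove w) (eweight T H J {w} *
          eweight T H J ((C.insideAbove w ∪ C.carrierAbove w).erase w)))) := by
  have hmw : ∀ w, Measurable (eweight (S := S) T H J {w} *
      eweight T H J ((C.insideAbove w ∪ C.carrierAbove w).erase w)) := fun w =>
    (measurable_eweight _).mul (measurable_eweight _)
  have hmp : Measurable (∏ w ∈ T.sphere (n + 1), eweight (S := S) T H J {w} *
      eweight T H J ((C.insideAbove w ∪ C.carrierAbove w).erase w)) := by
    rw [Finset.prod_fn]
    exact Finset.measurable_prod _ fun w _ => hmw w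
  have hsub : (T.ball n : Set V) ⊆
      (((T.sphere (n + 1)).biUnion C.insideAbove : Finset V) : Set V)ᶜ := fun x hx hx' =>
    Finset.disjoint_left.1 (disjoint_ball_insideAbove C) hx hx'
  have hdb : DependsOn (eweight (S := S) T H J (T.ball n)) (T.ball n : Set V) :=
    dependsOn_eweight fun y hy => by
      refine Or.inr ⟨hy, ?_⟩
      have := (BoundedRootedTree.parent_below (T := T) y).dist_le
      rw [BoundedRootedTree.mem_ball] at hy
      simp only [Finset.mem_coe, BoundedRootedTree.mem_ball]
      omega
  rw [eweight_inside_union_carrier hball hsph]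
  conv_lhs => rw [inside_eq_ball_union hball]
  rw [lmarginal_union _ _ (hF.mul ((measurable_eweight _).mul hmp)) (disjoint_ball_insideAbove C)]
  congr 1
  rw [← mul_assoc, lmarginal_mul_of_dependsOn dx ((hFd.mul hdb).mono hsub) hmp, mul_assoc]
  congr 2
  have hbelow : ∀ w y, y ∈ C.insideAbove w ∪ C.carrierAbove w → T.Below w y := by
    intro w x hx
    rw [Finset.mem_union, C.mem_insideAbove_iff, C.mem_carrierAbove_iff] at hx
    tauto
  refine lmarginal_biUnion_prod dx _ _ _ (fun w _ => hmw w) (fun w hw w' hw' hne => ?_)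
    fun w hw w' hw' hne => ?_
  · refine Finset.disjoint_left.2 fun x hx hx' => hne ?_
    exact eq_of_below_of_mem_sphere hw hw' ((C.mem_insideAbove_iff).1 hx).2
      ((C.mem_insideAbove_iff).1 hx').2
  · rw [eweight_singleton_mul_erase (Finset.mem_union_left _ (C.mem_insideAbove (hsph hw)))]
    refine dependsOn_eweight fun y hy => Or.inr ⟨fun h => hne ?_, fun h => hne ?_⟩
    · exact eq_of_below_of_mem_sphere hw hw' (hbelow w y hy) ((C.mem_insideAbove_iff).1 h).2
    · exact eq_of_below_of_mem_sphere hw hw' (hbelow w y hy)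
        (((C.mem_insideAbove_iff).1 h).2.trans (BoundedRootedTree.parent_below y))

theorem lmarginal_ballWeight_mul_outerPartition (C : T.Cutset) {F : (V → S) → ℝ≥0∞}
    (hF : Measurable F) :
    lmarginal (fun _ => dx) (T.ball n) (F * (eweight T H J (T.ball n) *
        ∏ w ∈ T.sphere (n + 1), edgeIntegral T H J dx w *
          lmarginal (fun _ => dx) (C.insideAbove w)
            (eweight T H J ((C.insideAbove w ∪ C.carrierAbove w).erase w)))) =
      outerPartition dx H J n C *
        lmarginal (fun _ => dx) (T.ball n) (F * ballWeight T H J dx n) := by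
  rw [← lmarginal_mul_of_dependsOn dx (dependsOn_outerPartition C)
    (hF.mul measurable_ballWeight), Finset.prod_mul_distrib, ballWeight, outerPartition]
  congr 1
  ring

/-- Replacing each branch integral by its decoupled version costs one factor `r` per vertex of the
sphere, in either direction. -/
theorem lmarginal_inside_le {r : ℝ≥0∞} {C : T.Cutset} (hball : T.ball n ⊆ C.inside)
    (hsph : T.sphere (n + 1) ⊆ C.inside)
    (hfree : ∀ w ∈ T.sphere (n + 1), NearlyFree T H J dx r C w) {F : (V → S) → ℝ≥0∞}
    (hF : Measurable F) (hFd : DependsOn F (T.ball n : Set V)) (η : V → S) :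
    lmarginal (fun _ => dx) C.inside (F * eweight T H J (C.inside ∪ C.carrier)) η ≤
        r ^ (T.sphere (n + 1)).card * (outerPartition dx H J n C η *
          lmarginal (fun _ => dx) (T.ball n) (F * ballWeight T H J dx n) η) ∧
      outerPartition dx H J n C η *
          lmarginal (fun _ => dx) (T.ball n) (F * ballWeight T H J dx n) η ≤
        r ^ (T.sphere (n + 1)).card *
          lmarginal (fun _ => dx) C.inside (F * eweight T H J (C.inside ∪ C.carrier)) η := by
  have hmw : ∀ w, Measurable (eweight (S := S) T H J {w} *
      eweight T H J ((C.insideAbove w ∪ C.carrierAbove w).erase w)) := fun w =>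
    (measurable_eweight _).mul (measurable_eweight _)
  have hconst : ∀ {f : (V → S) → ℝ≥0∞}, Measurable f → ∀ c : ℝ≥0∞,
      c * lmarginal (fun _ => dx) (T.ball n) f η =
        lmarginal (fun _ => dx) (T.ball n) (fun ζ => c * f ζ) η := fun hf c =>
    (lintegral_const_mul c (hf.comp measurable_updateFinset)).symm
  have hprod : ∀ {g : V → (V → S) → ℝ≥0∞}, (∀ w, Measurable (g w)) →
      Measurable (∏ w ∈ T.sphere (n + 1), g w) := fun hg => by
    rw [Finset.prod_fn]
    exact Finset.measurable_prod _ fun w _ => hg w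
  have h := congrFun (lmarginal_ballWeight_mul_outerPartition (dx := dx) (H := H) (J := J) (n := n)
    C hF) η
  rw [Pi.mul_apply] at h
  rw [lmarginal_inside_eq hball hsph hF hFd, ← h, hconst, hconst]
  · constructor
    · refine lmarginal_mono (fun ζ => ?_) η
      simp only [Pi.mul_apply, Finset.prod_apply]
      refine (mul_le_mul_right (mul_le_mul_right (Finset.prod_le_prod' fun w hw =>
        (hfree w hw ζ).1) _) _).trans_eq ?_
      rw [Finset.prod_mul_distrib, Finset.prod_const]
      ring
    · refine lmarginal_mono (fun ζ => ?_) η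
      simp only [Pi.mul_apply, Finset.prod_apply]
      refine (mul_le_mul_right (mul_le_mul_right (Finset.prod_le_prod' fun w hw =>
        (hfree w hw ζ).2) _) _).trans_eq ?_
      rw [Finset.prod_mul_distrib, Finset.prod_const]
      ring
  · exact hF.mul ((measurable_eweight _).mul (hprod fun w => (hmw w).lmarginal _))
  · exact hF.mul ((measurable_eweight _).mul (hprod fun w =>
      (measurable_edgeIntegral w).mul ((measurable_eweight _).lmarginal _)))

end Comparison

/-! ### Uniqueness of the Gibbs state when branches are nearly free. -/

section Uniqueness

variable {V S : Type*} [DecidableEq V] [MetricSpace S] [MeasurableSpace S]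
  {T : BoundedRootedTree V} {H : EnergyFunction S} {J : Sym2 V → ℝ≥0} {dx : Measure S} {n : ℕ}

theorem lmarginal_ball_mul_ballWeight_const {F : (V → S) → ℝ≥0∞}
    (hFd : DependsOn F (T.ball n : Set V)) (η η' : V → S) :
    lmarginal (fun _ => dx) (T.ball n) (F * ballWeight T H J dx n) η =
      lmarginal (fun _ => dx) (T.ball n) (F * ballWeight T H J dx n) η' := by
  have h := dependsOn_lmarginal dx (L := T.ball n) (hFd.mul (dependsOn_ballWeight (T := T)
    (H := H) (J := J) (dx := dx)))
  rw [Set.sdiff_self] at h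
  exact h.empty η η'

variable [CompactSpace S] [IsProbabilityMeasure dx]

theorem lmarginal_ballWeight_pos_lt_top (η : V → S) :
    0 < lmarginal (fun _ => dx) (T.ball n) (ballWeight T H J dx n) η ∧
      lmarginal (fun _ => dx) (T.ball n) (ballWeight T H J dx n) η < ⊤ := by
  have : Nonempty (V → S) := ⟨η⟩
  have hb : ∀ U : Finset V, ∃ a b : ℝ≥0, 0 < a ∧ ∀ ζ : V → S, (a : ℝ≥0∞) ≤ eweight T H J U ζ ∧
      eweight T H J U ζ ≤ b := by
    intro U
    have hc := continuous_weight (S := S) T H J U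
    obtain ⟨a, -, ha⟩ := isCompact_univ.exists_isMinOn Set.univ_nonempty hc.continuousOn
    obtain ⟨b, -, hb⟩ := isCompact_univ.exists_isMaxOn Set.univ_nonempty hc.continuousOn
    exact ⟨_, _, weight_pos T H J U a, fun ζ => ⟨ENNReal.coe_le_coe.2 (ha (Set.mem_univ ζ)),
      ENNReal.coe_le_coe.2 (hb (Set.mem_univ ζ))⟩⟩
  choose a b ha hab using hb
  have hlow : ∀ ζ, ((a (T.ball n) * ∏ w ∈ T.sphere (n + 1), a {w} : ℝ≥0) : ℝ≥0∞) ≤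
      ballWeight T H J dx n ζ := by
    intro ζ
    simp only [ballWeight, Pi.mul_apply, Finset.prod_apply, ENNReal.coe_mul,
      ENNReal.ofNNReal_finsetProd]
    refine mul_le_mul' (hab _ ζ).1 (Finset.prod_le_prod' fun w _ => ?_)
    rw [← lmarginal_const_eq dx {w} (a {w}) ζ]
    exact lmarginal_mono (fun ζ => (hab _ ζ).1) ζ
  have hup : ∀ ζ, ballWeight T H J dx n ζ ≤
      ((b (T.ball n) * ∏ w ∈ T.sphere (n + 1), b {w} : ℝ≥0) : ℝ≥0∞) := by
    intro ζ
    simp only [ballWeight, Pi.mul_apply, Finset.prod_apply, ENNReal.coe_mul,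
      ENNReal.ofNNReal_finsetProd]
    refine mul_le_mul' (hab _ ζ).2 (Finset.prod_le_prod' fun w _ => ?_)
    rw [← lmarginal_const_eq dx {w} (b {w}) ζ]
    exact lmarginal_mono (fun ζ => (hab _ ζ).2) ζ
  have hlow' := lmarginal_mono (μ := fun _ => dx) (s := T.ball n) hlow η
  have hup' := lmarginal_mono (μ := fun _ => dx) (s := T.ball n) hup η
  rw [lmarginal_const_eq] at hlow' hup'
  exact ⟨lt_of_lt_of_le (ENNReal.coe_pos.2 (mul_pos (ha _)
    (Finset.prod_pos fun w _ => ha {w}))) hlow', lt_of_le_of_lt hup' ENNReal.coe_lt_top⟩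

variable [Countable V] [BorelSpace S]

/-- The probability of an event depending on the ball of radius `n` under the limiting Gibbs
measure on this ball. -/
def ballProb (T : BoundedRootedTree V) (H : EnergyFunction S) (J : Sym2 V → ℝ≥0) (dx : Measure S)
    (n : ℕ) (η : V → S) (A : Set (V → S)) : ℝ≥0∞ :=
  lmarginal (fun _ => dx) (T.ball n) (A.indicator 1 * ballWeight T H J dx n) η /
    lmarginal (fun _ => dx) (T.ball n) (ballWeight T H J dx n) η

theorem ballProb_add_compl (η : V → S) {A : Set (V → S)} (hA : MeasurableSet A) :
    ballProb T H J dx n η A + ballProb T H J dx n η Aᶜ = 1 := by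
  obtain ⟨h1, h2⟩ := lmarginal_ballWeight_pos_lt_top (T := T) (H := H) (J := J) (dx := dx)
    (n := n) η
  rw [ballProb, ballProb, ← ENNReal.add_div]
  have hm : Measurable ((A.indicator 1 : (V → S) → ℝ≥0∞) * ballWeight T H J dx n) :=
    (measurable_one.indicator hA).mul measurable_ballWeight
  have : lmarginal (fun _ => dx) (T.ball n) (A.indicator 1 * ballWeight T H J dx n) η +
      lmarginal (fun _ => dx) (T.ball n) (Aᶜ.indicator 1 * ballWeight T H J dx n) η =
      lmarginal (fun _ => dx) (T.ball n) (ballWeight T H J dx n) η := by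
    simp only [lmarginal]
    refine (lintegral_add_left (hm.comp measurable_updateFinset) _).symm.trans ?_
    refine lintegral_congr fun ξ => ?_
    by_cases h : Function.updateFinset η (T.ball n) ξ ∈ A <;> simp [h]
  rw [this, ENNReal.div_self h1.ne' h2.ne]

/-- The comparison is used once for the event and once for the normalization, whence the square; the
dependence on `η` sits in the outer partition function, which cancels. -/
theorem resample_inside_le {r : ℝ≥0∞} {C : T.Cutset} (hball : T.ball n ⊆ C.inside)
    (hsph : T.sphere (n + 1) ⊆ C.inside)
    (hfree : ∀ w ∈ T.sphere (n + 1), NearlyFree T H J dx r C w) {A : Set (V → S)}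
    (hA : MeasurableSet A) (hAd : DependsOn (· ∈ A) (T.ball n : Set V)) (η η' : V → S) :
    resample dx (weight T H J (C.inside ∪ C.carrier)) C.inside η A ≤
      (r ^ (T.sphere (n + 1)).card) ^ 2 * ballProb T H J dx n η' A := by
  have hF : Measurable (A.indicator 1 : (V → S) → ℝ≥0∞) := measurable_one.indicator hA
  have hFd : DependsOn (A.indicator 1 : (V → S) → ℝ≥0∞) (T.ball n : Set V) := by
    intro x y h
    have hxy : x ∈ A ↔ y ∈ A := iff_of_eq (hAd h)
    by_cases hx : x ∈ A
    · simp [hx, hxy.1 hx]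
    · simp [hx, mt hxy.2 hx]
  have hone : (1 : (V → S) → ℝ≥0∞) * ballWeight T H J dx n = ballWeight T H J dx n := one_mul _
  have h1d : DependsOn (1 : (V → S) → ℝ≥0∞) (T.ball n : Set V) := fun _ _ _ => rfl
  have hb := (lmarginal_inside_le hball hsph hfree hF hFd η).1
  have hb1 := (lmarginal_inside_le hball hsph hfree measurable_one h1d η).2
  rw [one_mul, one_mul] at hb1
  obtain ⟨hp, ht⟩ := lmarginal_eweight_pos_lt_top (T := T) (H := H) (J := J) (dx := dx)
    (C.inside ∪ C.carrier) C.inside η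
  obtain ⟨hp', ht'⟩ := lmarginal_ballWeight_pos_lt_top (T := T) (H := H) (J := J) (dx := dx)
    (n := n) η
  have hconst := lmarginal_ball_mul_ballWeight_const (T := T) (H := H) (J := J) (dx := dx) h1d η η'
  rw [one_mul] at hconst
  rw [← lintegral_indicator_one hA, lintegral_resample dx (measurable_weight _) _ _ hF, ballProb,
    ← lmarginal_ball_mul_ballWeight_const hFd η η', ← hconst]
  refine (ENNReal.div_le_iff hp.ne' ht.ne).2 (hb.trans ?_)
  generalize lmarginal (fun _ => dx) (T.ball n) (A.indicator 1 * ballWeight T H J dx n) η = p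
  change _ ≤ _ * lmarginal (fun _ => dx) C.inside (eweight T H J (C.inside ∪ C.carrier)) η
  generalize lmarginal (fun _ => dx) C.inside (eweight T H J (C.inside ∪ C.carrier)) η = b at *
  generalize lmarginal (fun _ => dx) (T.ball n) (ballWeight T H J dx n) η = p₁ at *
  generalize outerPartition dx H J n C η = z at *
  generalize r ^ (T.sphere (n + 1)).card = R at *
  calc R * (z * p) = R * ((p / p₁) * (z * p₁)) := by
        rw [mul_left_comm (p / p₁), ENNReal.div_mul_cancel hp'.ne' ht'.ne]
    _ ≤ R * ((p / p₁) * (R * b)) := by gcongr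
    _ = R ^ 2 * (p / p₁) * b := by ring

theorem IsGibbsState.apply_le {μ : Measure (V → S)} (hμ : IsGibbsState T H J dx μ) {r : ℝ≥0∞}
    {C : T.Cutset} (hball : T.ball n ⊆ C.inside) (hsph : T.sphere (n + 1) ⊆ C.inside)
    (hfree : ∀ w ∈ T.sphere (n + 1), NearlyFree T H J dx r C w) {A : Set (V → S)}
    (hA : MeasurableSet A) (hAd : DependsOn (· ∈ A) (T.ball n : Set V)) (η' : V → S) :
    μ A ≤ (r ^ (T.sphere (n + 1)).card) ^ 2 * ballProb T H J dx n η' A := by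
  have := hμ.1
  have hA' : MeasurableSet (Function.updateFinset η' C.inside ⁻¹' A) := measurable_updateFinset hA
  -- The event only concerns the ball, so filling in `η'` outside `C.inside` exhibits it as an event
  -- about the inside spins.
  have heq : (fun (ζ : V → S) (x : C.inside) => ζ x) ⁻¹'
      (Function.updateFinset η' C.inside ⁻¹' A) = A := by
    ext ζ
    refine iff_of_eq (hAd fun i hi => ?_)
    simp [Function.updateFinset, hball hi]
  have h := hμ.map_restrict_apply C hA'
  rw [heq] at h
  rw [h]
  refine (lintegral_mono fun η => resample_inside_le hball hsph hfree hA hAd η η').trans ?_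
  rw [lintegral_const, measure_univ, mul_one]

/-- If the Gibbs measures beyond far cutsets are arbitrarily close to being free, uniformly in the
boundary conditions, then there is at most one Gibbs state. -/
theorem not_phaseTransition_of_nearlyFree
    (h : ∀ w : V, w ≠ T.root → ∀ r : ℝ≥0, 1 < r →
      ∃ C : T.Cutset, w ∈ C.inside ∧ NearlyFree T H J dx r C w) :
    ¬ PhaseTransition T H J dx := by
  rintro ⟨μ, ν, hμ, hν, hne⟩
  have hμp := hμ.1
  have hνp := hν.1
  obtain ⟨η⟩ : Nonempty (V → S) := nonempty_of_isProbabilityMeasure μ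
  have key : ∀ μ : Measure (V → S), IsGibbsState T H J dx μ → ∀ (n : ℕ) (A : Set (V → S)),
      MeasurableSet A → DependsOn (· ∈ A) (T.ball n : Set V) → μ A ≤ ballProb T H J dx n η A := by
    intro μ hμ n A hA hAd
    have hbound : ∀ r : ℝ≥0, 1 < r →
        μ A ≤ ((r : ℝ≥0∞) ^ (T.sphere (n + 1)).card) ^ 2 * ballProb T H J dx n η A := by
      intro r hr
      have hC : ∀ w, ∃ C : T.Cutset, w ∈ T.sphere (n + 1) →
          w ∈ C.inside ∧ NearlyFree T H J dx r C w := by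
        intro w
        by_cases hw : w = T.root
        -- The root lies on no sphere of positive radius, so any cutset will do.
        · exact ⟨T.sphereCutset 0, fun h => by subst hw; simp at h⟩
        · obtain ⟨C, h1, h2⟩ := h w hw r hr
          exact ⟨C, fun _ => ⟨h1, h2⟩⟩
      choose C hC using hC
      have hC' : ∀ w ∈ T.sphere (n + 1), w ∈ (C w).inside := fun w hw => (hC w hw).1
      refine hμ.apply_le (BoundedRootedTree.ball_subset_inside_glueCutset n C hC')
        (fun w hw => BoundedRootedTree.mem_inside_of_sphere n C hC' hw) (fun w hw => ?_) hA hAd η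
      have := (hC w hw).2
      rw [NearlyFree] at this ⊢
      rwa [BoundedRootedTree.insideAbove_glueCutset n C hC' hw,
        BoundedRootedTree.carrierAbove_glueCutset n C hC' hw]
    -- The exponent depends only on `n`, so the error factor tends to one as `r` decreases to one.
    have hcont : Continuous fun r : ℝ≥0 =>
        (((r ^ (T.sphere (n + 1)).card) ^ 2 : ℝ≥0) : ℝ≥0∞) :=
      ENNReal.continuous_coe.comp ((continuous_id.pow _).pow _)
    have htend : Tendsto (fun r : ℝ≥0 => ((r : ℝ≥0∞) ^ (T.sphere (n + 1)).card) ^ 2 *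
        ballProb T H J dx n η A) (nhdsWithin 1 (Set.Ioi 1)) (nhds (ballProb T H J dx n η A)) := by
      have h1 := (hcont.tendsto 1).mono_left (nhdsWithin_le_nhds (s := Set.Ioi 1))
      simp only [one_pow, ENNReal.coe_one, ENNReal.coe_pow] at h1
      have h2 := ENNReal.Tendsto.mul_const (b := ballProb T H J dx n η A) h1 (Or.inl one_ne_zero)
      rwa [one_mul] at h2
    exact ge_of_tendsto htend (eventually_nhdsWithin_of_forall fun r hr => hbound r hr)
  have heq : ∀ μ : Measure (V → S), IsGibbsState T H J dx μ → ∀ (n : ℕ) (A : Set (V → S)),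
      MeasurableSet A → DependsOn (· ∈ A) (T.ball n : Set V) → μ A = ballProb T H J dx n η A := by
    intro μ hμ n A hA hAd
    have hp := hμ.1
    refine le_antisymm (key μ hμ n A hA hAd) ?_
    -- Both sides are probabilities, so the upper bound for the complement gives the lower bound for
    -- `A`.
    have h1 := key μ hμ n Aᶜ hA.compl fun x y hxy => by
      have := hAd hxy
      simp only [Set.mem_compl_iff, this]
    have h2 := ballProb_add_compl (T := T) (H := H) (J := J) (dx := dx) (n := n) η hA
    have h3 := prob_add_prob_compl (μ := μ) hA
    have hfin : μ Aᶜ ≠ ⊤ := measure_ne_top μ _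
    refine ENNReal.le_of_add_le_add_right hfin ?_
    rw [h3, ← h2]
    gcongr
  -- Finite-dimensional marginals determine the measure, and every finite set of vertices lies in a
  -- ball.
  refine hne (IsProjectiveLimit.unique (P := fun I : Finset V => μ.map I.restrict)
    (fun I => rfl) fun I => ?_)
  ext s hs
  rw [Measure.map_apply (Finset.measurable_restrict I) hs,
    Measure.map_apply (Finset.measurable_restrict I) hs]
  have hAm := Finset.measurable_restrict (X := fun _ : V => S) I hs
  have hAd : DependsOn (· ∈ I.restrict (π := fun _ : V => S) ⁻¹' s)
      (T.ball (I.sup fun x => T.graph.dist T.root x) : Set V) := by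
    intro x y hxy
    have : I.restrict (π := fun _ : V => S) x = I.restrict y := funext fun i =>
      hxy i (by
        rw [Finset.mem_coe, BoundedRootedTree.mem_ball]
        exact Finset.le_sup (f := fun x => T.graph.dist T.root x) i.2)
    simp only [Set.mem_preimage, this]
  rw [heq μ hμ _ _ hAm hAd, heq ν hν _ _ hAm hAd]

end Uniqueness

/-! ### From uniformly small density deviations to uniqueness. -/

section Density

/-- A measure whose density is within `ε` of one is comparable to the reference measure. -/
theorem lintegral_bounds_of_rnDeriv {S : Type*} [MeasurableSpace S] {m dx : Measure S}
    [IsFiniteMeasure m] [IsProbabilityMeasure dx] (hac : m ≪ dx) {ε : ℝ} (hε : 0 ≤ ε)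
    (h : eLpNorm (fun s => (m.rnDeriv dx s).toReal - 1) ∞ dx ≤ ENNReal.ofReal ε)
    {f : S → ℝ≥0∞} (hf : Measurable f) :
    ∫⁻ s, f s ∂m ≤ ENNReal.ofReal (1 + ε) * ∫⁻ s, f s ∂dx ∧
      ENNReal.ofReal (1 - ε) * ∫⁻ s, f s ∂dx ≤ ∫⁻ s, f s ∂m := by
  have hae : ∀ᵐ s ∂dx, ENNReal.ofReal (1 - ε) ≤ m.rnDeriv dx s ∧
      m.rnDeriv dx s ≤ ENNReal.ofReal (1 + ε) := by
    rw [eLpNorm_exponent_top] at h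
    filter_upwards [ae_le_eLpNormEssSup (f := fun s => (m.rnDeriv dx s).toReal - 1) (μ := dx),
      Measure.rnDeriv_lt_top m dx] with s hs hlt
    have h1 := hs.trans h
    rw [Real.enorm_eq_ofReal_abs, ENNReal.ofReal_le_ofReal_iff hε, abs_le] at h1
    rw [← ENNReal.ofReal_toReal hlt.ne]
    exact ⟨ENNReal.ofReal_le_ofReal (by linarith), ENNReal.ofReal_le_ofReal (by linarith)⟩
  have hm : ∫⁻ s, f s ∂m = ∫⁻ s, m.rnDeriv dx s * f s ∂dx := by
    conv_lhs => rw [← Measure.withDensity_rnDeriv_eq m dx hac]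
    exact lintegral_withDensity_eq_lintegral_mul _ (Measure.measurable_rnDeriv m dx) hf
  rw [hm, ← lintegral_const_mul _ hf, ← lintegral_const_mul _ hf]
  constructor
  · refine lintegral_mono_ae ?_
    filter_upwards [hae] with s hs
    gcongr
    exact hs.2
  · refine lintegral_mono_ae ?_
    filter_upwards [hae] with s hs
    gcongr
    exact hs.1

variable {V S : Type*} [MetricSpace S] [MeasurableSpace S] {T : BoundedRootedTree V}
  {H : EnergyFunction S}
  {J : Sym2 V → ℝ≥0} {dx : Measure S} [IsProbabilityMeasure dx]

theorem map_gibbsMeasure_absolutelyContinuous {Γ : SimpleGraph V} {L D : Finset V} (δ : D → S)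
    (x : L) : (gibbsMeasure Γ H J dx L D δ).map (fun η => η x) ≪ dx := by
  have h1 : gibbsMeasure Γ H J dx L D δ ≪ Measure.pi fun _ : L => dx :=
    withDensity_absolutelyContinuous _ _
  have h2 := h1.map (measurable_pi_apply x)
  rwa [(measurePreserving_eval (fun _ : L => dx) x).map_eq] at h2

variable [Countable V] [DecidableEq V] [CompactSpace S] [BorelSpace S]

/-- The branch influences the edge factor at `w` only through the law of the spin at `w`, whose
density lies between `1 - ε` and `1 + ε`. -/
theorem nearlyFree_of_eLpNorm_le {C : T.Cutset} {w : V} (hw : w ∈ C.inside) (hwr : w ≠ T.root)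
    {ε : ℝ} (hε : 0 ≤ ε) {r : ℝ≥0∞} (h1 : ENNReal.ofReal (1 + ε) ≤ r)
    (h2 : 1 ≤ r * ENNReal.ofReal (1 - ε))
    (h : ∀ δ : C.carrier → S,
      eLpNorm (fun s => marginalDensity H J dx C δ w hw s - 1) ∞ dx ≤ ENNReal.ofReal ε) :
    NearlyFree T H J dx r C w := by
  intro η
  have hmarg := map_gibbsMeasure_insideAbove T H J dx C η hw
  have hm := h fun y => η y
  have hac := map_gibbsMeasure_absolutelyContinuous (Γ := T.graph) (H := H) (J := J) (dx := dx)
    (fun y : C.carrierAbove w => η y) ⟨w, C.mem_insideAbove hw⟩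
  simp only [marginalDensity] at hm
  rw [hmarg] at hm hac
  set A := C.insideAbove w
  set Q := (A ∪ C.carrierAbove w).erase w
  have := isProbabilityMeasure_resample dx (measurable_weight (T := T) (H := H) (J := J) Q)
    (continuous_weight T H J Q) (weight_pos T H J Q) A η
  have := Measure.isProbabilityMeasure_map (μ := resample dx (weight T H J Q) A η)
    (measurable_pi_apply w).aemeasurable
  -- The edge factor as a function of the spin at `w`, with the spin at the parent frozen; the
  -- parent is not in `A`, so integration over `A` leaves it fixed.
  let f : S → ℝ≥0∞ := fun y => eweight T H J {w} (Function.update η w y)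
  have hf : Measurable f := (measurable_eweight {w}).comp (measurable_update η)
  have hb := lintegral_bounds_of_rnDeriv hac hε hm hf
  have hpar : T.parent w ∉ A := fun hp => by
    have h3 := ((C.mem_insideAbove_iff).1 hp).2.dist_le
    have h4 := (T.parent_spec hwr).2
    omega
  have hfw : ∫⁻ s, f s ∂dx = edgeIntegral T H J dx w η := by
    rw [edgeIntegral, lmarginal_singleton]
  have hfev : Measurable fun ζ : V → S => f (ζ w) := hf.comp (measurable_pi_apply w)
  have hint : ∫⁻ s, f s ∂(resample dx (weight T H J Q) A η).map (fun ζ => ζ w) =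
      lmarginal (fun _ => dx) A (eweight T H J {w} * eweight T H J Q) η /
        lmarginal (fun _ => dx) A (eweight T H J Q) η := by
    rw [lintegral_map hf (measurable_pi_apply w),
      lintegral_resample dx (measurable_weight Q) A η hfev]
    congr 1
    refine lintegral_congr fun ξ => congrArg
      (· * eweight T H J Q (Function.updateFinset η A ξ)) ?_
    refine dependsOn_eweight (s := {w, T.parent w}) ?_ ?_
    · intro y hy
      rw [Finset.mem_singleton] at hy
      subst hy
      simp
    · rintro i (rfl | rfl)
      · simp
      · have hne : T.parent w ≠ w := (T.parent_spec hwr).1.ne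
        simp only [Function.update_of_ne hne, Function.updateFinset, hpar, dite_false]
  obtain ⟨hp, ht⟩ := lmarginal_eweight_pos_lt_top (T := T) (H := H) (J := J) (dx := dx) Q A η
  rw [hfw, hint] at hb
  rw [ENNReal.div_le_iff hp.ne' ht.ne, ENNReal.le_div_iff_mul_le (Or.inl hp.ne') (Or.inl ht.ne)]
    at hb
  constructor
  · refine hb.1.trans ?_
    rw [mul_assoc]
    gcongr
  · calc _ ≤ (r * ENNReal.ofReal (1 - ε)) * (edgeIntegral T H J dx w η *
          lmarginal (fun _ => dx) A (eweight T H J Q) η) := le_mul_of_one_le_left (by simp) h2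
      _ = r * (ENNReal.ofReal (1 - ε) * edgeIntegral T H J dx w η *
          lmarginal (fun _ => dx) A (eweight T H J Q) η) := by ring
      _ ≤ _ := by
        gcongr
        exact hb.2

theorem exists_deviation_of_phaseTransition (h : PhaseTransition T H J dx) :
    ∃ v : V, ∀ C : ℕ → T.Cutset, BoundedRootedTree.ApproachesInfinity C →
      ∃ δ : ∀ n, (C n).carrier → S, infDeviation H J dx C δ v ≠ 0 := by
  by_contra hno
  push Not at hno
  refine not_phaseTransition_of_nearlyFree (fun w hw r hr => ?_) h
  have hr' : (1 : ℝ) < r := hr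
  have hr0 : (0 : ℝ) < r := by linarith
  -- Chosen so that `1 - ε = 1 / r`; then also `1 + ε ≤ r`.
  set ε : ℝ := (r - 1) / r
  have hε : 0 < ε := div_pos (by linarith) hr0
  have hre : ε * r = r - 1 := div_mul_cancel₀ _ hr0.ne'
  have h1 : ENNReal.ofReal (1 + ε) ≤ (r : ℝ≥0∞) := by
    rw [← ENNReal.ofReal_coe_nnreal]
    refine ENNReal.ofReal_le_ofReal ?_
    nlinarith
  have h2 : 1 ≤ (r : ℝ≥0∞) * ENNReal.ofReal (1 - ε) := by
    rw [← ENNReal.ofReal_coe_nnreal, ← ENNReal.ofReal_mul hr0.le, ENNReal.one_le_ofReal]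
    nlinarith
  obtain ⟨C, -, hC⟩ := hno w
  by_contra hfar
  push Not at hfar
  have hex : ∀ (C : T.Cutset), ∃ δ : C.carrier → S, ∀ hv : w ∈ C.inside,
      ENNReal.ofReal ε ≤ eLpNorm (fun s => marginalDensity H J dx C δ w hv s - 1) ∞ dx := by
    intro C
    by_cases hv : w ∈ C.inside
    · by_contra hcon
      push Not at hcon
      refine hfar C hv (nearlyFree_of_eLpNorm_le hv hw hε.le h1 h2 fun δ => ?_)
      obtain ⟨_, hδ⟩ := hcon δ
      exact hδ.le
    · obtain ⟨s⟩ : Nonempty S := nonempty_of_isProbabilityMeasure dx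
      exact ⟨fun _ => s, fun h => absurd h hv⟩
  choose δ hδ using hex
  have h0 := hC fun n => δ (C n)
  have : ENNReal.ofReal ε ≤ infDeviation H J dx C (fun n => δ (C n)) w :=
    le_iInf₂ fun n hv => hδ (C n) hv
  rw [h0] at this
  exact absurd (ENNReal.ofReal_pos.2 hε) (not_lt.2 this)

end Density

/-! ### Uniqueness of the invariant probability measure. -/

section InvariantMeasure

/-- A transitive compact group action has at most one invariant probability measure. -/
theorem eq_of_smulInvariantMeasure {G S : Type*} [Group G] [TopologicalSpace G]
    [IsTopologicalGroup G] [CompactSpace G] [TopologicalSpace.MetrizableSpace G] [MetricSpace S]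
    [CompactSpace S] [MeasurableSpace S] [BorelSpace S] [MulAction G S] [ContinuousSMul G S]
    [MulAction.IsPretransitive G S] (m m' : Measure S) [IsProbabilityMeasure m]
    [IsProbabilityMeasure m'] [SMulInvariantMeasure G S m] [SMulInvariantMeasure G S m'] :
    m = m' := by
  borelize G
  -- Makes continuous functions on `G × S` measurable for the product σ-algebra, as Fubini requires.
  have hsc : SecondCountableTopology G := by
    let _ := TopologicalSpace.metrizableSpaceMetric G
    infer_instance
  obtain ⟨x₀⟩ : Nonempty S := nonempty_of_isProbabilityMeasure m
  let l : Measure G := Measure.haar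
  have hl : l Set.univ ≠ 0 := (isOpen_univ.measure_pos l Set.univ_nonempty).ne'
  have hl' : l Set.univ ≠ ⊤ := measure_ne_top l _
  refine ext_of_forall_lintegral_eq_of_IsFiniteMeasure fun f => ?_
  have hf : Continuous fun p : G × S => (f (p.1⁻¹ • p.2) : ℝ≥0∞) :=
    ENNReal.continuous_coe.comp (f.continuous.comp (continuous_fst.inv.smul continuous_snd))
  have hfm : Measurable fun x => (f x : ℝ≥0∞) := f.continuous.measurable.coe_nnreal_ennreal
  -- Averaging over Haar measure removes `m`: the average of `f` over an orbit does not depend on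
  -- its base point. The inverse in `g⁻¹ • x` makes left invariance suffice.
  have key : ∀ (m : Measure S) [IsProbabilityMeasure m] [SMulInvariantMeasure G S m],
      l Set.univ * ∫⁻ x, f x ∂m = ∫⁻ g, f (g⁻¹ • x₀) ∂l := by
    intro m _ _
    have h1 : ∀ g : G, ∫⁻ x, (f (g⁻¹ • x) : ℝ≥0∞) ∂m = ∫⁻ x, f x ∂m := fun g =>
      (measurePreserving_smul g⁻¹ m).lintegral_comp hfm
    have h2 : ∀ x : S, ∫⁻ g, (f (g⁻¹ • x) : ℝ≥0∞) ∂l = ∫⁻ g, f (g⁻¹ • x₀) ∂l := by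
      intro x
      obtain ⟨k, rfl⟩ := MulAction.exists_smul_eq G x₀ x
      rw [← lintegral_mul_left_eq_self _ k]
      refine lintegral_congr fun g => ?_
      rw [smul_smul, mul_inv_rev, inv_mul_cancel_right]
    calc l Set.univ * ∫⁻ x, f x ∂m = ∫⁻ g, ∫⁻ x, (f (g⁻¹ • x) : ℝ≥0∞) ∂m ∂l := by
          simp only [h1, lintegral_const, mul_comm]
      _ = ∫⁻ x, ∫⁻ g, (f (g⁻¹ • x) : ℝ≥0∞) ∂l ∂m :=
          lintegral_lintegral_swap hf.measurable.aemeasurable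
      _ = ∫⁻ g, f (g⁻¹ • x₀) ∂l := by simp [h2]
  exact (ENNReal.mul_right_inj hl hl').1 ((key m).trans (key m').symm)

end InvariantMeasure

/-! ### Weak limits of kernel-invariant measures. -/

section Limit

variable {V S : Type*} [DecidableEq V] [MeasurableSpace S] {dx : Measure S}
  [IsProbabilityMeasure dx]

theorem bind_resample_resample [TopologicalSpace S] [CompactSpace S] {w w' g : (V → S) → ℝ≥0}
    (hw : Measurable w) (hc : Continuous w) (hpos : ∀ η, 0 < w η) (hg : Measurable g)
    (hw' : w' = g * w) {L M : Finset V} (hLM : L ⊆ M) (hgL : DependsOn g (L : Set V)ᶜ)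
    (η : V → S) : (resample dx w' M η).bind (resample dx w L) = resample dx w' M η := by
  ext s hs
  rw [Measure.bind_apply hs (measurable_resample dx hw L).aemeasurable,
    ← lintegral_indicator_one hs, ← lintegral_resample_resample dx hw hc hpos hg hw' hLM hgL
      (measurable_one.indicator hs) η]
  exact lintegral_congr fun ζ => (lintegral_indicator_one hs).symm

variable [Countable V] [MetricSpace S] [CompactSpace S] [BorelSpace S]

/-- Invariance under resampling passes to weak limits. -/
theorem bind_resample_eq_of_tendsto {ι : Type*} {l : Filter ι} [l.NeBot]
    {ν : ι → ProbabilityMeasure (V → S)} {μ : ProbabilityMeasure (V → S)}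
    (hν : Tendsto ν l (nhds μ)) {w : (V → S) → ℝ≥0} (hw : Continuous w) (hpos : ∀ η, 0 < w η)
    {L : Finset V}
    (h : ∀ᶠ i in l, (ν i : Measure (V → S)).bind (resample dx w L) = (ν i : Measure (V → S))) :
    (μ : Measure (V → S)).bind (resample dx w L) = (μ : Measure (V → S)) := by
  have hm := measurable_resample dx hw.measurable L
  have hlim := ProbabilityMeasure.tendsto_iff_forall_lintegral_tendsto.1 hν
  symm
  refine ext_of_forall_lintegral_eq_of_IsFiniteMeasure fun F => ?_
  have hF : Measurable fun ζ : V → S => (F ζ : ℝ≥0∞) :=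
    F.continuous.measurable.coe_nnreal_ennreal
  have hK := continuous_lintegral_resample dx hw hpos F.continuous L
  have hfin : ∀ η, ∫⁻ ζ, (F ζ : ℝ≥0∞) ∂resample dx w L η ≠ ⊤ := fun η => by
    have := isProbabilityMeasure_resample dx hw.measurable hw hpos L η
    exact (F.lintegral_lt_top_of_nnreal _).ne
  -- The kernel average of a continuous `F` is again a test function, so the invariance identity can
  -- be tested along the limit.
  let K : BoundedContinuousFunction (V → S) ℝ≥0 := BoundedContinuousFunction.mkOfCompact
    ⟨fun η => (∫⁻ ζ, (F ζ : ℝ≥0∞) ∂resample dx w L η).toNNReal,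
      continuous_iff_continuousAt.2 fun η =>
        (ENNReal.tendsto_toNNReal (hfin η)).comp hK.continuousAt⟩
  have hKe : ∀ η, (K η : ℝ≥0∞) = ∫⁻ ζ, (F ζ : ℝ≥0∞) ∂resample dx w L η := fun η =>
    ENNReal.coe_toNNReal (hfin η)
  rw [Measure.lintegral_bind hm.aemeasurable hF.aemeasurable]
  simp only [← hKe]
  refine tendsto_nhds_unique_of_eventuallyEq (hlim F) (hlim K) ?_
  filter_upwards [h] with i hi
  conv_lhs => rw [← hi]
  rw [Measure.lintegral_bind hm.aemeasurable hF.aemeasurable]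
  simp only [hKe]

/-- Weak convergence of measures is uniform over compact families of continuous functions. -/
theorem eventually_forall_abs_integral_sub_le {X Y ι : Type*} [TopologicalSpace X]
    [CompactSpace X] [MeasurableSpace X] [BorelSpace X] [TopologicalSpace Y] [CompactSpace Y]
    (f : C(Y, C(X, ℝ))) {l : Filter ι} {ν : ι → ProbabilityMeasure X} {μ : ProbabilityMeasure X}
    (hν : Tendsto ν l (nhds μ)) {ε : ℝ} (hε : 0 < ε) :
    ∀ᶠ i in l, ∀ y, |∫ x, f y x ∂(ν i : Measure X) - ∫ x, f y x ∂(μ : Measure X)| ≤ ε := by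
  have hint : ∀ (g : C(X, ℝ)) (m : ProbabilityMeasure X), Integrable g (m : Measure X) :=
    fun g m => (BoundedContinuousFunction.mkOfCompact g).integrable _
  have hdist : ∀ (y z : Y) (m : ProbabilityMeasure X), dist (f y) (f z) ≤ ε / 3 →
      |∫ x, f y x ∂(m : Measure X) - ∫ x, f z x ∂(m : Measure X)| ≤ ε / 3 := by
    intro y z m hyz
    rw [← integral_sub (hint _ m) (hint _ m)]
    have h := norm_integral_le_of_norm_le_const (μ := (m : Measure X)) (C := ε / 3)
      (f := fun x => f y x - f z x) (ae_of_all _ fun x => by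
        rw [← dist_eq_norm]
        exact (ContinuousMap.dist_apply_le_dist x).trans hyz)
    simpa using h
  -- A finite `ε / 3`-net of the family reduces uniform convergence to finitely many test functions.
  obtain ⟨t, -, ht⟩ := isCompact_univ.elim_nhds_subcover
    (fun z : Y => {y | dist (f y) (f z) < ε / 3}) fun z _ =>
      f.continuous.continuousAt.eventually (Metric.ball_mem_nhds (f z) (by positivity))
  have hev : ∀ z ∈ t, ∀ᶠ i in l,
      |∫ x, f z x ∂(ν i : Measure X) - ∫ x, f z x ∂(μ : Measure X)| < ε / 3 := fun z _ => by
    have := ProbabilityMeasure.tendsto_iff_forall_integral_tendsto.1 hν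
      (BoundedContinuousFunction.mkOfCompact (f z))
    exact this.eventually (Metric.ball_mem_nhds _ (by positivity))
  filter_upwards [(t.eventually_all (l := l)).2 hev] with i hi y
  obtain ⟨z, hz, hyz⟩ := Set.mem_iUnion₂.1 (ht (Set.mem_univ y))
  have h1 := hdist y z (ν i) (le_of_lt hyz)
  have h2 := hdist y z μ (le_of_lt hyz)
  have h3 := hi z hz
  rw [abs_le] at *
  rw [abs_lt] at h3
  constructor <;> linarith [h1.1, h1.2, h2.1, h2.2, h3.1, h3.2]

end Limit

/-! ### Continuous densities of single-site marginals. -/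

section SiteDensity

variable {V S : Type*} [DecidableEq V] [MetricSpace S] [MeasurableSpace S]
  (T : BoundedRootedTree V) (H : EnergyFunction S) (J : Sym2 V → ℝ≥0) (dx : Measure S)

/-- The conditional density of the spin at `v` given the spins at its neighbors. -/
def siteDensity (v : V) (p : S × (V → S)) : ℝ :=
  (weight T H J (T.star v) (Function.update p.2 v p.1) : ℝ) /
    (lmarginal (fun _ => dx) {v} (eweight T H J (T.star v)) p.2).toReal

theorem siteDensity_nonneg (v : V) (p : S × (V → S)) : 0 ≤ siteDensity T H J dx v p := by
  unfold siteDensity; positivity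

variable [Countable V] [CompactSpace S] [BorelSpace S] [IsProbabilityMeasure dx]

theorem continuous_siteDensity (v : V) : Continuous (siteDensity T H J dx v) := by
  have h1 : Continuous fun p : S × (V → S) => Function.update p.2 v p.1 :=
    continuous_snd.update v continuous_fst
  have h2 : Continuous fun η => (lmarginal (fun _ => dx) {v} (eweight T H J (T.star v)) η).toReal :=
    continuous_iff_continuousAt.2 fun η =>
      (ENNReal.tendsto_toReal (lmarginal_eweight_pos_lt_top _ _ η).2.ne).comp
        (continuous_lmarginal dx (continuous_weight T H J (T.star v)) {v}).continuousAt
  refine (NNReal.continuous_coe.comp ((continuous_weight T H J (T.star v)).comp h1)).div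
    (h2.comp continuous_snd) fun p => ?_
  obtain ⟨hp, ht⟩ := lmarginal_eweight_pos_lt_top (T := T) (H := H) (J := J) (dx := dx)
    (T.star v) {v} p.2
  exact (ENNReal.toReal_pos hp.ne' ht.ne).ne'

theorem resample_singleton_preimage (v : V) (η : V → S) {A : Set S} (hA : MeasurableSet A) :
    resample dx (weight T H J (T.star v)) {v} η ((fun ζ => ζ v) ⁻¹' A) =
      ∫⁻ s in A, ENNReal.ofReal (siteDensity T H J dx v (s, η)) ∂dx := by
  have hA' : MeasurableSet ((fun ζ : V → S => ζ v) ⁻¹' A) := measurable_pi_apply v hA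
  obtain ⟨hp, ht⟩ := lmarginal_eweight_pos_lt_top (T := T) (H := H) (J := J) (dx := dx)
    (T.star v) {v} η
  rw [← lintegral_indicator_one hA', lintegral_resample dx (measurable_weight _) _ _
    (measurable_one.indicator hA'), ← lintegral_indicator hA]
  change _ / lmarginal (fun _ => dx) {v} (eweight T H J (T.star v)) η = _
  have hm : Measurable fun s => (((fun ζ : V → S => ζ v) ⁻¹' A).indicator 1 *
      eweight T H J (T.star v) : (V → S) → ℝ≥0∞) (Function.update η v s) :=
    ((measurable_one.indicator hA').mul (measurable_eweight _)).comp (measurable_update η)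
  rw [ENNReal.div_eq_inv_mul]
  refine (congrArg _ (congrFun (lmarginal_singleton _ v) η)).trans
    ((lintegral_const_mul _ hm).symm.trans (lintegral_congr fun s => ?_))
  by_cases hs : s ∈ A
  · rw [Set.indicator_of_mem hs, siteDensity, ENNReal.ofReal_div_of_pos
      (ENNReal.toReal_pos hp.ne' ht.ne), ENNReal.ofReal_toReal ht.ne, ENNReal.ofReal_coe_nnreal,
      ENNReal.div_eq_inv_mul]
    simp [hs, eweight]
  · simp [hs]

/-- Fubini applied to the one-site invariance identity. The density is the integral against `μ` of a
continuous function not depending on `μ`, which is what upgrades weak convergence to convergence in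
sup norm. -/
theorem map_eval_eq_withDensity {v : V} {μ : Measure (V → S)} [IsProbabilityMeasure μ]
    (h : μ.bind (resample dx (weight T H J (T.star v)) {v}) = μ) :
    (μ.map fun η => η v) =
      dx.withDensity fun s => ENNReal.ofReal (∫ η, siteDensity T H J dx v (s, η) ∂μ) := by
  have hc := continuous_siteDensity T H J dx v
  ext A hA
  have hA' : MeasurableSet ((fun ζ : V → S => ζ v) ⁻¹' A) := measurable_pi_apply v hA
  rw [Measure.map_apply (measurable_pi_apply v) hA, withDensity_apply _ hA]
  conv_lhs => rw [← h]
  rw [Measure.bind_apply hA' (measurable_resample dx (measurable_weight _) _).aemeasurable]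
  simp only [resample_singleton_preimage T H J dx v _ hA]
  rw [lintegral_lintegral_swap (f := fun η s => ENNReal.ofReal (siteDensity T H J dx v (s, η)))
    ((ENNReal.measurable_ofReal.comp hc.measurable).comp measurable_swap).aemeasurable]
  refine lintegral_congr fun s => ?_
  have hcs : Continuous fun η => siteDensity T H J dx v (s, η) :=
    hc.comp (continuous_const.prodMk continuous_id)
  exact (ofReal_integral_eq_lintegral_ofReal
    ((BoundedContinuousFunction.mkOfCompact ⟨_, hcs⟩).integrable μ)
    (ae_of_all _ fun η => siteDensity_nonneg T H J dx v _)).symm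

variable {T H J dx}

theorem rnDeriv_map_eval {v : V} {μ : Measure (V → S)} [IsProbabilityMeasure μ]
    (h : μ.bind (resample dx (weight T H J (T.star v)) {v}) = μ) :
    ∀ᵐ s ∂dx, ((μ.map fun η => η v).rnDeriv dx s).toReal =
      ∫ η, siteDensity T H J dx v (s, η) ∂μ := by
  have hc := continuous_siteDensity T H J dx v
  have hm : Measurable fun s => ENNReal.ofReal (∫ η, siteDensity T H J dx v (s, η) ∂μ) :=
    ENNReal.measurable_ofReal.comp
      (hc.measurable.stronglyMeasurable.integral_prod_right' (ν := μ)).measurable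
  rw [map_eval_eq_withDensity T H J dx h]
  filter_upwards [Measure.rnDeriv_withDensity dx hm] with s hs
  rw [hs, ENNReal.toReal_ofReal (integral_nonneg fun η => siteDensity_nonneg T H J dx v _)]

/-- The edge factors in `Q \ U` do not touch `L`, so they cancel when `L` is resampled. -/
theorem bind_resample_weight {L M U Q : Finset V} (hLM : L ⊆ M) (hUQ : U ⊆ Q)
    (hU : ∀ y ∈ Q, y ∉ U → y ∉ L ∧ T.parent y ∉ L) (η : V → S) :
    (resample dx (weight T H J Q) M η).bind (resample dx (weight T H J U) L) =
      resample dx (weight T H J Q) M η := by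
  refine bind_resample_resample (g := weight T H J (Q \ U)) (measurable_weight U)
    (continuous_weight T H J U) (weight_pos T H J U) (measurable_weight _) ?_ hLM ?_ η
  · exact (Finset.prod_sdiff hUQ).symm
  · refine dependsOn_weight T H J fun y hy => Or.inr ?_
    rw [Finset.mem_sdiff] at hy
    exact hU y hy.1 hy.2

end SiteDensity

/-! ### Decoupling the spins that are not above a vertex. -/

section FreeOutside

/-- With free boundary conditions outside the descendants of `v`, the rest of the tree does not
influence the spin at `v`. -/
theorem map_eval_resample_inside_eq {V S : Type*} (G : Type*) [Countable V] [DecidableEq V]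
    [MetricSpace S] [CompactSpace S] [MeasurableSpace S] [BorelSpace S] {T : BoundedRootedTree V}
    {H : EnergyFunction S} {J : Sym2 V → ℝ≥0} {dx : Measure S} [IsProbabilityMeasure dx] [Group G]
    [MulAction G S] [IsIsometricSMul G S] [MulAction.IsPretransitive G S]
    [SMulInvariantMeasure G S dx] {C : T.Cutset} {v : V} (hv : v ∈ C.inside) (η : V → S) :
    (resample dx (weight T H J (C.inside ∪ C.carrierAbove v)) C.inside η).map (fun ζ => ζ v) =
      (resample dx (weight T H J ((C.insideAbove v ∪ C.carrierAbove v).erase v))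
        (C.insideAbove v) η).map fun ζ => ζ v := by
  set A := C.insideAbove v with hAdef
  set D := C.carrierAbove v
  set Q := (A ∪ D).erase v with hQdef
  set R := C.inside \ A with hRdef
  have hmA : ∀ x, x ∈ A ↔ x ∈ C.inside ∧ T.Below v x := fun x => C.mem_insideAbove_iff
  have hmD : ∀ x, x ∈ D ↔ x ∈ C.carrier ∧ T.Below v x := fun x => C.mem_carrierAbove_iff
  have hmR : ∀ x, x ∈ R ↔ x ∈ C.inside ∧ ¬ T.Below v x := fun x => by
    rw [hRdef, Finset.mem_sdiff, hmA]; tauto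
  have hbQ : ∀ x ∈ Q, T.Below v x ∧ x ≠ v := fun x hx => by
    rw [hQdef, Finset.mem_erase, Finset.mem_union, hmA, hmD] at hx; tauto
  have hvA : v ∈ A := C.mem_insideAbove hv
  have hAL : A ⊆ C.inside := fun x hx => ((hmA x).1 hx).1
  have hunion : C.inside = A ∪ R := by rw [hRdef, Finset.union_sdiff_of_subset hAL]
  have hdisj : Disjoint A R := Finset.disjoint_sdiff
  have hQ : C.inside ∪ D = Q ∪ insert v R := by
    ext x
    rw [hQdef, Finset.mem_union, Finset.mem_union, Finset.mem_erase, Finset.mem_insert,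
      Finset.mem_union, hmA, hmD, hmR]
    by_cases hx : x = v
    · subst hx; tauto
    · tauto
  have hQdisj : Disjoint Q (insert v R) := by
    refine Finset.disjoint_left.2 fun x hx hx' => ?_
    rcases Finset.mem_insert.1 hx' with h | h
    · exact (hbQ x hx).2 h
    · exact ((hmR x).1 h).2 (hbQ x hx).1
  -- All of the influence on the branch at `v` from the spins in `R`, including the edge from `v` to
  -- its parent.
  let q : (V → S) → ℝ≥0∞ := lmarginal (fun _ => dx) R (eweight T H J (insert v R))
  have hqd : DependsOn q {v} := by
    refine (dependsOn_lmarginal dx (s := (insert v R : Finset V))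
      (dependsOn_eweight fun y hy => ?_)).mono ?_
    · by_cases hr : y = T.root
      · exact Or.inl hr
      refine Or.inr ⟨hy, Finset.mem_coe.2 (Finset.mem_insert_of_mem ((hmR _).2 ?_))⟩
      rcases Finset.mem_insert.1 hy with rfl | h
      · refine ⟨C.mem_inside_of_below hv (BoundedRootedTree.parent_below y), fun hb => ?_⟩
        have h1 := hb.dist_le
        have h2 := (T.parent_spec hr).2
        omega
      · rw [hmR] at h
        exact ⟨C.mem_inside_of_below h.1 (BoundedRootedTree.parent_below y),
          fun hb => h.2 (hb.trans (BoundedRootedTree.parent_below y))⟩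
    · intro x hx
      simp only [Finset.coe_insert, Set.mem_sdiff, Set.mem_insert_iff, Finset.mem_coe] at hx
      exact hx.1.resolve_right hx.2
  -- `q` depends on the spin at `v` only and is invariant under the diagonal action; transitivity
  -- makes it constant, so it cancels in the ratio.
  have hqc : ∀ ζ ζ', q ζ = q ζ' := by
    intro ζ ζ'
    obtain ⟨g, hg⟩ := MulAction.exists_smul_eq G (ζ v) (ζ' v)
    have h1 : q ζ' = q (g • ζ) := hqd fun i hi => by
      rw [Set.mem_singleton_iff] at hi
      subst hi
      exact hg.symm
    rw [h1]
    simp only [q]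
    rw [lmarginal_smul dx R (measurable_eweight _)]
    simp only [eweight, weight_smul]
    rfl
  obtain ⟨hq0, hqt⟩ := lmarginal_eweight_pos_lt_top (T := T) (H := H) (J := J) (dx := dx)
    (insert v R) R η
  change 0 < q η at hq0
  change q η < ⊤ at hqt
  have key : ∀ f : S → ℝ≥0∞, Measurable f →
      lmarginal (fun _ => dx) C.inside ((fun ζ => f (ζ v)) * eweight T H J (C.inside ∪ D)) η =
        q η * lmarginal (fun _ => dx) A ((fun ζ => f (ζ v)) * eweight T H J Q) η := by
    intro f hf
    have hfm : Measurable fun ζ : V → S => f (ζ v) := hf.comp (measurable_pi_apply v)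
    have hmQ : Measurable ((fun ζ : V → S => f (ζ v)) * eweight T H J Q) :=
      hfm.mul (measurable_eweight Q)
    rw [hQ, eweight_union hQdisj, hunion, ← mul_assoc,
      lmarginal_union _ _ (hmQ.mul (measurable_eweight _)) hdisj,
      lmarginal_mul_of_dependsOn dx (L := R) _ (measurable_eweight _)]
    · have : ((fun ζ : V → S => f (ζ v)) * eweight T H J Q) * q =
          fun ζ => q η * ((fun ζ : V → S => f (ζ v)) * eweight T H J Q) ζ := by
        ext ζ
        rw [Pi.mul_apply, hqc ζ η, mul_comm]
      change lmarginal (fun _ => dx) A (_ * q) η = _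
      rw [this]
      exact lintegral_const_mul _ (hmQ.comp measurable_updateFinset)
    · refine DependsOn.mul (fun x y h => ?_) (dependsOn_eweight fun y hy => Or.inr ⟨?_, ?_⟩)
      · have : x v = y v := h v fun hvR => ((hmR v).1 hvR).2 (T.below_refl v)
        simp only [this]
      · exact fun h => ((hmR y).1 h).2 (hbQ y hy).1
      · exact fun h => ((hmR _).1 h).2 ((hbQ y hy).1.below_parent (hbQ y hy).2.symm)
  have key1 : lmarginal (fun _ => dx) C.inside (eweight T H J (C.inside ∪ D)) η =
      q η * lmarginal (fun _ => dx) A (eweight T H J Q) η := by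
    have h := key (fun _ => 1) measurable_const
    have h1 : ∀ U, (fun _ : V → S => (1 : ℝ≥0∞)) * eweight T H J U = eweight T H J U :=
      fun U => one_mul _
    rwa [h1, h1] at h
  ext s hs
  have hs' : MeasurableSet ((fun ζ : V → S => ζ v) ⁻¹' s) := measurable_pi_apply v hs
  rw [Measure.map_apply (measurable_pi_apply v) hs, Measure.map_apply (measurable_pi_apply v) hs,
    ← lintegral_indicator_one hs', ← lintegral_indicator_one hs',
    lintegral_resample dx (measurable_weight _) _ _ (measurable_one.indicator hs'),
    lintegral_resample dx (measurable_weight _) _ _ (measurable_one.indicator hs')]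
  have h := key (s.indicator 1) (measurable_one.indicator hs)
  change lmarginal (fun _ => dx) C.inside ((fun ζ => s.indicator 1 (ζ v)) *
      eweight T H J (C.inside ∪ D)) η /
        lmarginal (fun _ => dx) C.inside (eweight T H J (C.inside ∪ D)) η =
    lmarginal (fun _ => dx) A ((fun ζ => s.indicator 1 (ζ v)) * eweight T H J Q) η /
      lmarginal (fun _ => dx) A (eweight T H J Q) η
  rw [h, key1, ENNReal.mul_div_mul_left _ _ hq0.ne' hqt.ne]

end FreeOutside

/-! ### Deviation of densities implies symmetry breaking. -/

section Breaking

variable {V S G : Type*} [Countable V] [DecidableEq V] [Group G] [TopologicalSpace G]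
  [IsTopologicalGroup G] [CompactSpace G] [TopologicalSpace.MetrizableSpace G] [MetricSpace S]
  [CompactSpace S] [MeasurableSpace S] [BorelSpace S] [MulAction G S] [ContinuousSMul G S]
  [IsIsometricSMul G S] [MulAction.IsPretransitive G S] {T : BoundedRootedTree V}
  {H : EnergyFunction S} {J : Sym2 V → ℝ≥0} {dx : Measure S} [IsProbabilityMeasure dx]
  [SMulInvariantMeasure G S dx]

theorem SymmetryBreaking.of_deviation {v : V} {C : ℕ → T.Cutset}
    (hC : BoundedRootedTree.ApproachesInfinity C) {δ : ∀ n, (C n).carrier → S}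
    (h : infDeviation H J dx C δ v ≠ 0) : SymmetryBreaking T H J dx G := by
  obtain ⟨s₀⟩ : Nonempty S := nonempty_of_isProbabilityMeasure dx
  let η : ℕ → V → S := fun n x => if hx : x ∈ (C n).carrier then δ n ⟨x, hx⟩ else s₀
  -- Edges to cutset vertices that are not above `v` are omitted, giving the free boundary there
  -- that the decoupling needs.
  let Q : ℕ → Finset V := fun n => (C n).inside ∪ (C n).carrierAbove v
  let ν : ℕ → ProbabilityMeasure (V → S) := fun n =>
    ⟨resample dx (weight T H J (Q n)) (C n).inside (η n),
      isProbabilityMeasure_resample dx (measurable_weight _) (continuous_weight T H J _)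
        (weight_pos T H J _) _ _⟩
  -- A limit along a nonprincipal ultrafilter replaces the choice of a convergent subsequence.
  obtain ⟨μ, -, hμ⟩ := (isCompact_univ (X := ProbabilityMeasure (V → S))).ultrafilter_le_nhds
    ((hyperfilter ℕ).map ν) (by simp)
  have hlim : Tendsto ν (hyperfilter ℕ : Filter ℕ) (nhds μ) := hμ
  have hhyp : ∀ {p : ℕ → Prop}, (∀ᶠ n in atTop, p n) → ∀ᶠ n in (hyperfilter ℕ : Filter ℕ), p n :=
    fun hp => (Nat.hyperfilter_le_atTop) hp
  have hbind : ∀ L U : Finset V, (∀ y, y ∈ L ∨ T.parent y ∈ L → y ∈ U) →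
      ∀ᶠ n in atTop, (ν n : Measure (V → S)).bind (resample dx (weight T H J U) L) =
        (ν n : Measure (V → S)) := by
    intro L U hU
    -- Once the cutset is beyond `L ∪ U`, the omitted edges are far from `L`, so the free boundary
    -- does not affect the limit being a Gibbs state.
    filter_upwards [hC.eventually_subset (L ∪ U)] with n hn
    refine bind_resample_weight ((Finset.subset_union_left).trans hn)
      (((Finset.subset_union_right).trans hn).trans Finset.subset_union_left) (fun y _ hy => ?_) _
    exact ⟨fun h => hy (hU y (Or.inl h)), fun h => hy (hU y (Or.inr h))⟩
  have hbindμ : ∀ L U : Finset V, (∀ y, y ∈ L ∨ T.parent y ∈ L → y ∈ U) →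
      (μ : Measure (V → S)).bind (resample dx (weight T H J U) L) = (μ : Measure (V → S)) :=
    fun L U hU => bind_resample_eq_of_tendsto hlim (continuous_weight T H J U)
      (weight_pos T H J U) (hhyp (hbind L U hU))
  refine ⟨μ, isGibbsState_of_bind_eq fun C => hbindμ _ _ fun y hy => ?_, v, fun hinv => h ?_⟩
  · rw [Finset.mem_union]
    rcases hy with hy | hy
    · exact Or.inl hy
    · exact C.mem_inside_or_mem_carrier hy
  have hstar : ∀ y, y ∈ ({v} : Finset V) ∨ T.parent y ∈ ({v} : Finset V) → y ∈ T.star v := by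
    intro y hy
    rw [BoundedRootedTree.mem_star]
    simpa using hy
  have := Measure.isProbabilityMeasure_map (μ := (μ : Measure (V → S)))
    (measurable_pi_apply v).aemeasurable
  have hmarg : ((μ : Measure (V → S)).map fun η => η v) = dx :=
    eq_of_smulInvariantMeasure (G := G) _ _
  have hone : ∀ᵐ s ∂dx, ∫ η, siteDensity T H J dx v (s, η) ∂(μ : Measure (V → S)) = 1 := by
    have h1 := rnDeriv_map_eval (hbindμ {v} (T.star v) hstar)
    rw [hmarg] at h1
    filter_upwards [h1, Measure.rnDeriv_self dx] with s hs hs'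
    rw [← hs, hs', ENNReal.toReal_one]
  -- Seen as a compact family of test functions indexed by the spin at `v`, the conditional
  -- densities have averages converging uniformly to the limiting density one.
  let f : C(S, C(V → S, ℝ)) := ContinuousMap.curry ⟨_, continuous_siteDensity T H J dx v⟩
  refine le_antisymm (ENNReal.le_of_forall_pos_le_add fun ε hε _ => ?_) zero_le
  have hev := eventually_forall_abs_integral_sub_le f hlim (ε := ε) hε
  obtain ⟨n, hn, hbn, hvn⟩ := (hev.and ((hhyp (hbind {v} (T.star v) hstar)).and
    (hhyp (hC v)))).exists
  rw [zero_add]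
  refine (iInf₂_le n hvn).trans ?_
  have hmd : ∀ s, marginalDensity H J dx (C n) (δ n) v hvn s =
      (((ν n : Measure (V → S)).map fun η => η v).rnDeriv dx s).toReal := by
    intro s
    have hη : (fun y : (C n).carrierAbove v => η n y) =
        fun y => δ n ⟨y.1, (C n).mem_of_mem_carrierAbove y.2⟩ := by
      ext y
      simp only [η, (C n).mem_of_mem_carrierAbove y.2, dite_true]
    have h1 := map_gibbsMeasure_insideAbove T H J dx (C n) (η n) hvn
    rw [hη, ← map_eval_resample_inside_eq G hvn] at h1
    rw [marginalDensity, h1]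
    rfl
  have hsd := rnDeriv_map_eval (μ := (ν n : Measure (V → S))) hbn
  rw [eLpNorm_exponent_top]
  refine eLpNormEssSup_le_of_ae_nnnorm_bound ?_
  filter_upwards [hsd, hone] with s hs hs1
  rw [hmd, hs, ← hs1, ← NNReal.coe_le_coe, coe_nnnorm, Real.norm_eq_abs]
  exact hn s

end Breaking

end

theorem proposition1p1
    {G S V : Type*}
    [Group G] [TopologicalSpace G] [IsTopologicalGroup G] [CompactSpace G]
    [TopologicalSpace.MetrizableSpace G]
    [MetricSpace S] [CompactSpace S] [MeasurableSpace S] [BorelSpace S]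
    [MulAction G S] [ContinuousSMul G S] [IsIsometricSMul G S] [MulAction.IsPretransitive G S]
    -- the (unique) invariant probability measure
    (dx : Measure S) [IsProbabilityMeasure dx] [SMulInvariantMeasure G S dx]
    (H : EnergyFunction S)
    (T : BoundedRootedTree V)
    -- nonnegative interaction strengths (only the values on edges matter)
    (J : Sym2 V → ℝ≥0) :
    List.TFAE [
      ∃ v : V, ∀ C : ℕ → T.Cutset, BoundedRootedTree.ApproachesInfinity C →
        ∃ δ : ∀ n, (C n).carrier → S, infDeviation H J dx C δ v ≠ 0,
      ∃ v : V, ∃ C : ℕ → T.Cutset, BoundedRootedTree.ApproachesInfinity C ∧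
        ∃ δ : ∀ n, (C n).carrier → S, infDeviation H J dx C δ v ≠ 0,
      SymmetryBreaking T H J dx G,
      PhaseTransition T H J dx] := by
  classical
  have := T.countable_vertices
  tfae_have 1 → 2
  | ⟨v, h⟩ => ⟨v, T.sphereCutset, T.approachesInfinity_sphereCutset,
      h _ T.approachesInfinity_sphereCutset⟩
  tfae_have 2 → 3
  | ⟨_, _, hC, _, h⟩ => SymmetryBreaking.of_deviation hC h
  tfae_have 3 → 4 := PhaseTransition.of_symmetryBreaking
  tfae_have 4 → 1 := exists_deviation_of_phaseTransition
  tfae_finish
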